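/- **Setting.** Let $k\ge 0$, let $V$ be a finite vertex set, and let $\mathrm{SC}$ (the glued complex) and pairwise vertex-disjoint $\hat{\mathrm{SC}}^{(1)},\dots,\hat{\mathrm{SC}}^{(\kappa)}$ ($\kappa\ge1$, each with at least one $k$-simplex) be finite simplicial complexes with vertices in $V$; put $\hat{\mathrm{SC}}=\bigcup_i\hat{\mathrm{SC}}^{(i)}$. Let $\Sigma_\ell,\hat\Sigma_\ell$ be the sets of $\ell$-simplices of $\mathrm{SC},\hat{\mathrm{SC}}$ (with $\Sigma_{-1}=\hat\Sigma_{-1}=\emptyset$), and $\mathfrak N_\ell=\Sigma_\ell\cap\hat\Sigma_\ell$, $\mathfrak C_\ell=\Sigma_\ell\setminus\hat\Sigma_\ell$, $\mathfrak D_\ell=\hat\Sigma_\ell\setminus\Sigma_\ell$. Orient all simplices, with the same orientation in both complexes, and let $B_\ell$ be the boundary matrices. Let $w_{k+1}\ge0$ and $\hat w_{k+1}\ge 0$ be weights on $\Sigma_{k+1}$ and $\hat\Sigma_{k+1}$ that agree on $\mathfrak N_{k+1}$; for $\ell=k,k-1$ put $w_\ell(\sigma)=\sum w_{\ell+1}(\tau)$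 over the cofaces $\tau\in\Sigma_{\ell+1}$ of $\sigma$, and likewise $\hat w_\ell$ in $\hat{\mathrm{SC}}$. Let $\tilde w_k=|B_{k+1}[\mathfrak N_k,\mathfrak N_{k+1}]|\,w_{k+1}$ and $\tilde w_{k-1}=|B_k[\mathfrak N_{k-1},\mathfrak N_k]|\,\tilde w_k$. All $w_\ell,\hat w_\ell$ on $\Sigma_\ell,\hat\Sigma_\ell$ and all $\tilde w_\ell$ on $\mathfrak N_\ell$ ($\ell=k,k-1$) are assumed positive. With $W_\ell=\mathrm{diag}(w_\ell)$ and $A_\ell=W_{\ell-1}^{-1/2}B_\ell W_\ell^{1/2}$ let $L_d=A_k^\top A_k$, $L_u=A_{k+1}A_{k+1}^\top$, $\mathcal L_k=L_d+L_u$, $\beta_k=\dim(\ker A_k/\operatorname{im}A_{k+1})$, and let $\hat L_d,\hat L_u,\hat{\mathcal L}_k$ be the same matrices for $\hat{\mathrm{SC}}$; thus $\hat{\mathcal L}_k$ is block diagonal, with blocks the Laplacians $\hat{\mathcal L}_k^{(ii)}$ of $\hat{\mathrm{SC}}^{(i)}$. Let $\delta_i$ be the smallest nonzero eigenvalue of $\hat{\mathcal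 L}_k^{(ii)}$. For $\bullet=d,u$ extend $L_\bullet$ to $\Sigma_k\cup\hat\Sigma_k$ by the diagonal block $\hat L_\bullet[\mathfrak D_k,\mathfrak D_k]$ and zeros, extend $\hat L_\bullet$ by the diagonal block $L_\bullet[\mathfrak C_k,\mathfrak C_k]$ and zeros, and let $\mathsf{DiffL}_k^{\rm down}$ (for $\bullet=d$) and $\mathsf{DiffL}_k^{\rm up}$ (for $\bullet=u$) be the first extended matrix minus the second. $\|\cdot\|$ is the spectral norm. **Assumptions.** 1. $\beta_k(\mathrm{SC})=\sum_i\beta_k(\hat{\mathrm{SC}}^{(i)})$. 2. All eigenvalues of the principal submatrices $\mathcal L_k[\mathfrak C_k,\mathfrak C_k]$ and $\hat{\mathcal L}_k[\mathfrak D_k,\mathfrak D_k]$ are at least $\min_i\delta_i$. 3. The numbers $\epsilon_k,\epsilon_{k-1},\epsilon'_k,\epsilon'_{k-1}\ge0$ satisfy, for all $\sigma\in\mathfrak N_k$ and $\nu\in\mathfrak N_{k-1}$ and for $(v_k,v_{k-1})$ equal to $(w_k,w_{k-1})$ and to $(\hat w_k,\hat w_{k-1})$, $$\sqrt{\tfrac{v_k(\sigma)}{\tilde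 w_k(\sigma)}}-1\le\sqrt{\epsilon_k},\quad \tfrac{v_k(\sigma)}{\tilde w_k(\sigma)}-1\le\epsilon_k,\quad \tfrac{v_{k-1}(\nu)}{\tilde w_{k-1}(\nu)}-1\le\min\{\sqrt{\epsilon_{k-1}},\epsilon_{k-1}\},$$ $$\Big|\sqrt{\tfrac{\hat w_k(\sigma)}{w_k(\sigma)}}-1\Big|\le\sqrt{\epsilon_k'},\quad \Big|\sqrt{\tfrac{w_k(\sigma)}{\hat w_k(\sigma)}}-1\Big|\le\sqrt{\epsilon_k'},\quad \Big|\tfrac{\hat w_k(\sigma)}{w_k(\sigma)}-1\Big|\le\epsilon'_k,\quad \Big|\tfrac{\hat w_{k-1}(\nu)}{w_{k-1}(\nu)}-1\Big|\le\min\{\sqrt{\epsilon'_{k-1}},\epsilon'_{k-1}\}.$$ **Theorem.** With $\lambda_k=k+2$ and $\lambda_{k-1}=k+1$, $$\|\mathsf{DiffL}_k^{\rm down}\|^2\le\Big[2\sqrt{\epsilon_k'}+\epsilon_k'+\big(1+\sqrt{\epsilon_k'}\big)^2\sqrt{\epsilon_{k-1}'}+4\sqrt{\epsilon_{k-1}}\Big]^2\lambda_{k-1}^2,$$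 $$\|\mathsf{DiffL}_k^{\rm up}\|^2\le\Big[2\sqrt{\epsilon_k'}+\epsilon_k'+2\epsilon_k+4\sqrt{\epsilon_k}\Big]^2\lambda_k^2.$$ Moreover, for all matrices $Y$ and $\hat Y$ with $\beta_k=\beta_k(\mathrm{SC})$ columns that form orthonormal bases of $\ker\mathcal L_k$ and of $\ker\hat{\mathcal L}_k$, there is an orthogonal matrix $O\in\mathbb R^{\beta_k\times\beta_k}$ with $$\big\|Y_{\mathfrak N_k,:}-\hat Y_{\mathfrak N_k,:}O\big\|_F^2\le\frac{8\beta_k\big(\|\mathsf{DiffL}_k^{\rm down}\|^2+\|\mathsf{DiffL}_k^{\rm up}\|^2\big)}{\big(\min_i\delta_i\big)^2}.$$ -/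

import Mathlib

open scoped Matrix

noncomputable section

namespace HodgeGluing

variable {V : Type*} [Fintype V] [LinearOrder V]

/-! ### Simplicial complexes, boundary matrices, weights

A finite abstract simplicial complex on a finite point set `V` is Mathlib's
`PreAbstractSimplicialComplex V`: a family of nonempty finite subsets of `V` that is closed under
passing to nonempty subsets. -/

open Classical in
/-- The simplices with exactly `m` vertices, that is, the `(m - 1)`-dimensional simplices.
There are none with `0` vertices, so that there are no `(-1)`-dimensional simplices. -/
def cells (K : PreAbstractSimplicialComplex V) (m : ℕ) : Finset (Finset V) :=
  Finset.univ.filter fun σ => σ ∈ K ∧ σ.card = m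

/-- The sign of the face `ν` of `σ` for the orientations given by the order of `V`: it is
`(-1) ^ i` if `ν` arises from `σ` by deleting its `i`-th vertex (counted from `0`), and it is `0`
if `ν` is not a facet of `σ`. -/
def incidence (ν σ : Finset V) : ℝ :=
  ∑ v ∈ σ, if σ.erase v = ν then (-1 : ℝ) ^ (σ.filter fun u => u < v).card else 0

/-- The boundary matrix from the simplices with `m + 1` vertices to those with `m` vertices.
Every simplex carries an arbitrary orientation: `o σ = 1` if it is the one given by the order
of `V`, and `o σ = -1` if it is the opposite one. -/
def boundary (K : PreAbstractSimplicialComplex V) (o : Finset V → ℤˣ) (m : ℕ) :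
    Matrix (cells K m) (cells K (m + 1)) ℝ :=
  Matrix.of fun ν σ => ((o ν : ℤ) : ℝ) * ((o σ : ℤ) : ℝ) * incidence (ν : Finset V) (σ : Finset V)

/-- The total weight of the members of `S` that contain `ν`. -/
def degree (S : Finset (Finset V)) (w : Finset V → ℝ) (ν : Finset V) : ℝ :=
  ∑ τ ∈ S.filter (fun τ => ν ⊆ τ), w τ

/-- The weight `w_k` of the `k`-simplices, determined by the weight `w = w_{k+1}` of the
`(k+1)`-simplices: `w_k(σ) = ∑ w_{k+1}(τ)` over the cofaces `τ` of `σ`. -/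
def weightMid (K : PreAbstractSimplicialComplex V) (k : ℕ) (w : Finset V → ℝ) : Finset V → ℝ :=
  degree (cells K (k + 2)) w

/-- The weight `w_{k-1}` of the `(k-1)`-simplices: `w_{k-1}(ν) = ∑ w_k(σ)` over the cofaces `σ`
of `ν`. -/
def weightLow (K : PreAbstractSimplicialComplex V) (k : ℕ) (w : Finset V → ℝ) : Finset V → ℝ :=
  degree (cells K (k + 1)) (weightMid K k w)

/-- The weights of the `(k+1)`-simplices are nonnegative and those weights whose inverse square
roots enter the Laplacian are positive. -/
structure ValidWeights (K : PreAbstractSimplicialComplex V) (k : ℕ) (w : Finset V → ℝ) :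
    Prop where
  top_nonneg : ∀ τ ∈ cells K (k + 2), 0 ≤ w τ
  mid_pos : ∀ σ ∈ cells K (k + 1), 0 < weightMid K k w σ
  low_pos : ∀ ν ∈ cells K k, 0 < weightLow K k w ν

/-! ### The weighted Hodge Laplacian and its null space -/

/-- `W_{m-1}^{-1/2} B_m W_m^{1/2}` for weights `u` (rows) and `v` (columns). -/
def normBoundary (K : PreAbstractSimplicialComplex V) (o : Finset V → ℤˣ) (m : ℕ)
    (u v : Finset V → ℝ) : Matrix (cells K m) (cells K (m + 1)) ℝ :=
  Matrix.diagonal (fun ν : cells K m => (√(u ν))⁻¹) * boundary K o m *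
    Matrix.diagonal (fun σ : cells K (m + 1) => √(v σ))

/-- The normalized boundary matrix `A_k`, from `k`-cochains to `(k-1)`-cochains. -/
def matA (K : PreAbstractSimplicialComplex V) (o : Finset V → ℤˣ) (k : ℕ) (w : Finset V → ℝ) :
    Matrix (cells K k) (cells K (k + 1)) ℝ :=
  normBoundary K o k (weightLow K k w) (weightMid K k w)

/-- The normalized boundary matrix `A_{k+1}`, from `(k+1)`-cochains to `k`-cochains. -/
def matA' (K : PreAbstractSimplicialComplex V) (o : Finset V → ℤˣ) (k : ℕ) (w : Finset V → ℝ) :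
    Matrix (cells K (k + 1)) (cells K (k + 2)) ℝ :=
  normBoundary K o (k + 1) (weightMid K k w) w

/-- The down Laplacian `A_kᵀ A_k` (it is `0` for `k = 0`). -/
def downLaplacian (K : PreAbstractSimplicialComplex V) (o : Finset V → ℤˣ) (k : ℕ)
    (w : Finset V → ℝ) : Matrix (cells K (k + 1)) (cells K (k + 1)) ℝ :=
  (matA K o k w)ᵀ * matA K o k w

/-- The up Laplacian `A_{k+1} A_{k+1}ᵀ`. -/
def upLaplacian (K : PreAbstractSimplicialComplex V) (o : Finset V → ℤˣ) (k : ℕ)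
    (w : Finset V → ℝ) : Matrix (cells K (k + 1)) (cells K (k + 1)) ℝ :=
  matA' K o k w * (matA' K o k w)ᵀ

/-- The weighted `k`-Hodge Laplacian. -/
def laplacian (K : PreAbstractSimplicialComplex V) (o : Finset V → ℤˣ) (k : ℕ)
    (w : Finset V → ℝ) : Matrix (cells K (k + 1)) (cells K (k + 1)) ℝ :=
  downLaplacian K o k w + upLaplacian K o k w

/-- The `k`-th Betti number, `dim (ker A_k / im A_{k+1})`. -/
def betti (K : PreAbstractSimplicialComplex V) (o : Finset V → ℤˣ) (k : ℕ)
    (w : Finset V → ℝ) : ℕ :=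
  Module.finrank ℝ
    (LinearMap.ker (Matrix.toLin' (matA K o k w)) ⧸
      (LinearMap.range (Matrix.toLin' (matA' K o k w))).submoduleOf
        (LinearMap.ker (Matrix.toLin' (matA K o k w))))

/-- The columns of `Y` are an orthonormal basis of the null space of `L`. -/
structure IsNullBasis {n : Type*} [Fintype n] [DecidableEq n] {b : ℕ}
    (L : Matrix n n ℝ) (Y : Matrix n (Fin b) ℝ) : Prop where
  orthonormal : Yᵀ * Y = 1
  span_eq : Submodule.span ℝ (Set.range Yᵀ) = LinearMap.ker (Matrix.toLin' L)

/-- The eigengap of a nonzero positive semidefinite matrix: its smallest nonzero eigenvalue. -/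
def eigengap {n : Type*} [Fintype n] [DecidableEq n] (L : Matrix n n ℝ) : ℝ :=
  sInf (spectrum ℝ L \ {0})

/-- The spectral norm. -/
def specNorm {n : Type*} [Fintype n] [DecidableEq n] (M : Matrix n n ℝ) : ℝ :=
  ‖Matrix.toEuclideanCLM (n := n) (𝕜 := ℝ) M‖

/-! ### Comparing two complexes -/

/-- The non-intersecting simplices with `m` vertices: those that belong to both complexes. -/
def common (K K' : PreAbstractSimplicialComplex V) (m : ℕ) : Finset (Finset V) :=
  cells K m ∩ cells K' m

/-- The weight `w̃_k`, in which only the non-intersecting `(k+1)`-simplices count. -/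
def commonMid (K K' : PreAbstractSimplicialComplex V) (k : ℕ) (w : Finset V → ℝ) :
    Finset V → ℝ :=
  degree (common K K' (k + 2)) w

/-- The weight `w̃_{k-1}`, in which only the non-intersecting `k`-simplices count, with their
weights `w̃_k`. -/
def commonLow (K K' : PreAbstractSimplicialComplex V) (k : ℕ) (w : Finset V → ℝ) :
    Finset V → ℝ :=
  degree (common K K' (k + 1)) (commonMid K K' k w)

/-- The matrix `M` on `S`, extended to all simplices by the diagonal block of `M'` on the simplices
of `T` that are not in `S`, and by `0` everywhere else. -/
def glue (S T : Finset (Finset V)) (M : Matrix S S ℝ) (M' : Matrix T T ℝ)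
    (σ τ : Finset V) : ℝ :=
  if h : σ ∈ S ∧ τ ∈ S then M ⟨σ, h.1⟩ ⟨τ, h.2⟩
  else if h' : (σ ∈ T ∧ σ ∉ S) ∧ (τ ∈ T ∧ τ ∉ S) then M' ⟨σ, h'.1.1⟩ ⟨τ, h'.2.1⟩
  else 0

/-- The modified difference of a matrix `M` on `S` and a matrix `M'` on `T`, on `S ∪ T`:
`M` is extended by the diagonal block of `M'` on `T \ S`, and `M'` by the diagonal block of `M`
on `S \ T`. -/
def modDiff (S T : Finset (Finset V)) (M : Matrix S S ℝ) (M' : Matrix T T ℝ) :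
    Matrix (S ∪ T : Finset (Finset V)) (S ∪ T : Finset (Finset V)) ℝ :=
  Matrix.of fun σ τ => glue S T M M' σ τ - glue T S M' M σ τ

/-- The modified difference of the down Laplacians. -/
def diffDown (K K' : PreAbstractSimplicialComplex V) (o : Finset V → ℤˣ) (k : ℕ)
    (w w' : Finset V → ℝ) :
    Matrix (cells K (k + 1) ∪ cells K' (k + 1) : Finset (Finset V))
      (cells K (k + 1) ∪ cells K' (k + 1) : Finset (Finset V)) ℝ :=
  modDiff _ _ (downLaplacian K o k w) (downLaplacian K' o k w')

/-- The modified difference of the up Laplacians. -/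
def diffUp (K K' : PreAbstractSimplicialComplex V) (o : Finset V → ℤˣ) (k : ℕ)
    (w w' : Finset V → ℝ) :
    Matrix (cells K (k + 1) ∪ cells K' (k + 1) : Finset (Finset V))
      (cells K (k + 1) ∪ cells K' (k + 1) : Finset (Finset V)) ℝ :=
  modDiff _ _ (upLaplacian K o k w) (upLaplacian K' o k w')

/-- The diagonal block of a matrix `M` on `S` described by the members of `S` that are
not in `T`. -/
def blockOff (S T : Finset (Finset V)) (M : Matrix S S ℝ) :
    Matrix {σ : S // (σ : Finset V) ∉ T} {σ : S // (σ : Finset V) ∉ T} ℝ :=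
  M.submatrix Subtype.val Subtype.val

/-- The weights change only slightly. Here `N` and `N₀` are the non-intersecting `k`- and
`(k-1)`-simplices, `w`, `w'`, `wt` are the weights `w_k`, `ŵ_k`, `w̃_k`, and `u`, `u'`, `ut` are
the weights `w_{k-1}`, `ŵ_{k-1}`, `w̃_{k-1}`; `e`, `e₀` are `ε_k`, `ε_{k-1}` and `e'`, `e₀'` are
`ε'_k`, `ε'_{k-1}`. -/
structure SmallWeightChange (N N₀ : Finset (Finset V)) (w w' wt u u' ut : Finset V → ℝ)
    (e e₀ e' e₀' : ℝ) : Prop where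
  /- few simplices are created -/
  created_sqrt : ∀ σ ∈ N, √(w σ) / √(wt σ) - 1 ≤ √e
  created_inv_sqrt : ∀ σ ∈ N, (√(wt σ))⁻¹ / (√(w σ))⁻¹ - 1 ≤ √e
  created : ∀ σ ∈ N, w σ / wt σ - 1 ≤ e
  created_low_inv : ∀ ν ∈ N₀, (ut ν)⁻¹ / (u ν)⁻¹ - 1 ≤ √e₀
  created_low : ∀ ν ∈ N₀, u ν / ut ν - 1 ≤ e₀
  /- few simplices are destroyed -/
  destroyed_sqrt : ∀ σ ∈ N, √(w' σ) / √(wt σ) - 1 ≤ √e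
  destroyed_inv_sqrt : ∀ σ ∈ N, (√(wt σ))⁻¹ / (√(w' σ))⁻¹ - 1 ≤ √e
  destroyed : ∀ σ ∈ N, w' σ / wt σ - 1 ≤ e
  destroyed_low_inv : ∀ ν ∈ N₀, (ut ν)⁻¹ / (u' ν)⁻¹ - 1 ≤ √e₀
  destroyed_low : ∀ ν ∈ N₀, u' ν / ut ν - 1 ≤ e₀
  /- the net changes are small -/
  net_sqrt : ∀ σ ∈ N, |√(w' σ) / √(w σ) - 1| ≤ √e'
  net_sqrt_rev : ∀ σ ∈ N, |√(w σ) / √(w' σ) - 1| ≤ √e'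
  net : ∀ σ ∈ N, |w' σ / w σ - 1| ≤ e'
  net_low_inv : ∀ ν ∈ N₀, |(u ν)⁻¹ / (u' ν)⁻¹ - 1| ≤ √e₀'
  net_low : ∀ ν ∈ N₀, |u' ν / u ν - 1| ≤ e₀'

/-- A member of `S ∩ T` as a member of `S`. -/
def commonLeft {S T : Finset (Finset V)} (σ : (S ∩ T : Finset (Finset V))) : S :=
  ⟨σ, (Finset.mem_inter.mp σ.2).1⟩

/-- A member of `S ∩ T` as a member of `T`. -/
def commonRight {S T : Finset (Finset V)} (σ : (S ∩ T : Finset (Finset V))) : T :=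
  ⟨σ, (Finset.mem_inter.mp σ.2).2⟩

/-- The squared Frobenius distance of the rows of `Y` and `Z` at the members of `S ∩ T`. -/
def commonRowsDistSq {S T : Finset (Finset V)} {b : ℕ} (Y : Matrix S (Fin b) ℝ)
    (Z : Matrix T (Fin b) ℝ) : ℝ :=
  ∑ σ : (S ∩ T : Finset (Finset V)), ∑ j, (Y (commonLeft σ) j - Z (commonRight σ) j) ^ 2

end HodgeGluing

end

open HodgeGluing

/-! All matrices are extended by zero to the index set of all finite subsets of `V`, so that the two
complexes can be compared in one algebra. Let N, C, D be the common, created and destroyed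
`k`-simplices. In a modified difference the C×C and D×D blocks cancel; what remains is the
difference on N×N, and the couplings N×C of the first complex and N×D of the second, each with its
transpose (`specNorm_modDiff_le`).

Every block is a product of scaled incidence matrices, and one estimate,
`norm_scaledIncidence_sq_le`, controls them all: by Cauchy–Schwarz the squared norm is at most the
number of vertices of a column simplex times the largest ratio of the degree of a row to its weight.
With all cofaces the ratio is at most 1, which yields `k + 1` and `k + 2`; with created cofaces
only, the closeness of `w` to `w̃` makes it at most ε (`degree_sdiff_le`). This bounds the
couplings. On N×N the incidence signs agree, so the parts built from common simplices differ by
diagonal rescalings close to 1 (`norm_gram_rescale_sub_le`); the up Laplacian has in addition a part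
from the created and one from the destroyed `(k+1)`-simplices.

For the null spaces, extend the Laplacian of the disjoint union by the block of the glued one on C.
The extension is block diagonal; the eigenvalue bound on that block preserves the gap and adds no
null vectors. The glued null basis, extended by zero, is killed by the other extension. A
Davis–Kahan argument (`exists_orthogonal_null_frames`) bounds the distance of this basis from the
null space by the modified difference over the gap, and the Procrustes lemma
`exists_orthogonal_sum_sq_le` turns the distance into an orthogonal alignment. The gap of the
disjoint union is that of its pieces because an eigenvector restricts to each piece
(`eq_zero_or_iInf_eigengap_le`). -/

noncomputable section

namespace HodgeGluing

/-! ### Spectral norm estimates, Gram matrices and the Procrustes problem -/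

section LinearAlgebra

open scoped Matrix.Norms.L2Operator

variable {m n : Type*} [Fintype m] [Fintype n]

lemma sum_sq_eq_trace (A : Matrix m n ℝ) : ∑ i, ∑ j, A i j ^ 2 = (Aᵀ * A).trace := by
  simp only [Matrix.trace, Matrix.diag, Matrix.mul_apply, Matrix.transpose_apply, ← sq]
  exact Finset.sum_comm

variable [DecidableEq n]

lemma sum_sq_mulVec_le (M : Matrix m n ℝ) (x : n → ℝ) :
    ∑ i, (M *ᵥ x) i ^ 2 ≤ ‖M‖ ^ 2 * ∑ j, x j ^ 2 := by
  have h := M.l2_opNorm_mulVec (WithLp.toLp 2 x)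
  have h2 := pow_le_pow_left₀ (norm_nonneg _) h 2
  rw [mul_pow, EuclideanSpace.real_norm_sq_eq, EuclideanSpace.real_norm_sq_eq] at h2
  simpa using h2

lemma l2_opNorm_sq_le (M : Matrix m n ℝ) {c : ℝ} (hc : 0 ≤ c)
    (h : ∀ x : n → ℝ, ∑ i, (M *ᵥ x) i ^ 2 ≤ c * ∑ j, x j ^ 2) : ‖M‖ ^ 2 ≤ c := by
  have key : ‖M‖ ≤ √c := by
    rw [Matrix.l2_opNorm_def]
    refine ContinuousLinearMap.opNorm_le_bound _ (Real.sqrt_nonneg _) fun x => ?_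
    refine (sq_le_sq₀ (norm_nonneg _) (by positivity)).mp ?_
    rw [mul_pow, Real.sq_sqrt hc, EuclideanSpace.real_norm_sq_eq, EuclideanSpace.real_norm_sq_eq]
    simpa using h x.ofLp
  calc ‖M‖ ^ 2 ≤ √c ^ 2 := pow_le_pow_left₀ (norm_nonneg _) key 2
    _ = c := Real.sq_sqrt hc

lemma l2_opNorm_le_of_sq_le {M : Matrix m n ℝ} {c : ℝ} (h : ‖M‖ ^ 2 ≤ c) : ‖M‖ ≤ √c :=
  Real.le_sqrt_of_sq_le h

lemma l2_opNorm_transpose [DecidableEq m] (M : Matrix m n ℝ) : ‖Mᵀ‖ = ‖M‖ := by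
  rw [← Matrix.conjTranspose_eq_transpose_of_trivial, Matrix.l2_opNorm_conjTranspose]

lemma l2_opNorm_diagonal_le {d : n → ℝ} {c : ℝ} (hc : 0 ≤ c) (h : ∀ i, |d i| ≤ c) :
    ‖(Matrix.diagonal d : Matrix n n ℝ)‖ ≤ c := by
  rw [Matrix.l2_opNorm_diagonal]
  exact (pi_norm_le_iff_of_nonneg hc).mpr h

/-- Extending a vector by zero along the injection keeps its length, and the submatrix sees only
some of the entries of the image. -/
lemma l2_opNorm_submatrix_le [DecidableEq m] (M : Matrix n n ℝ) {f : m → n} (hf : Function.Injective f) :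
    ‖M.submatrix f f‖ ≤ ‖M‖ := by
  refine (sq_le_sq₀ (norm_nonneg _) (norm_nonneg _)).mp ?_
  refine l2_opNorm_sq_le _ (by positivity) fun x => ?_
  have hext : ∀ g : n → ℝ, ∑ j, g j * Function.extend f x 0 j = ∑ i, g (f i) * x i := by
    intro g
    rw [← Finset.sum_subset (Finset.subset_univ (Finset.univ.image f)),
      Finset.sum_image hf.injOn]
    · simp [hf.extend_apply]
    · intro j _ hj
      have : ¬ ∃ i, f i = j := by simpa using hj
      simp [Function.extend_apply' _ _ _ this]
  have h1 : ∀ i, (M.submatrix f f *ᵥ x) i = (M *ᵥ Function.extend f x 0) (f i) := by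
    intro i
    simp only [Matrix.mulVec, dotProduct, Matrix.submatrix_apply]
    exact (hext (M (f i))).symm
  have h2 : ∑ j, Function.extend f x 0 j ^ 2 = ∑ i, x i ^ 2 := by
    simp_rw [sq]
    rw [hext]
    simp [hf.extend_apply]
  calc ∑ i, (M.submatrix f f *ᵥ x) i ^ 2
      = ∑ j ∈ Finset.univ.image f, (M *ᵥ Function.extend f x 0) j ^ 2 := by
        rw [Finset.sum_image hf.injOn]; simp [h1]
    _ ≤ ∑ j, (M *ᵥ Function.extend f x 0) j ^ 2 :=
        Finset.sum_le_sum_of_subset_of_nonneg (Finset.subset_univ _) fun _ _ _ => sq_nonneg _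
    _ ≤ ‖M‖ ^ 2 * ∑ i, x i ^ 2 := by
        rw [← h2]; exact sum_sq_mulVec_le M _

/-- Multiplying a matrix from both sides by `1 + F` changes it little if `F` is small. -/
lemma norm_conj_sub_le (M F : Matrix n n ℝ) {s : ℝ} (hF : ‖F‖ ≤ s) :
    ‖(1 + F) * M * (1 + F) - M‖ ≤ (2 * s + s ^ 2) * ‖M‖ := by
  have h0 := norm_nonneg F
  have h1 := norm_nonneg M
  have e : (1 + F) * M * (1 + F) - M = F * M + M * F + F * M * F := by noncomm_ring
  have h2 : ‖F * M‖ ≤ s * ‖M‖ := (norm_mul_le _ _).trans (by gcongr)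
  have h3 : ‖M * F‖ ≤ ‖M‖ * s := (norm_mul_le _ _).trans (by gcongr)
  have h4 : ‖F * M * F‖ ≤ s * ‖M‖ * s :=
    (norm_mul_le _ _).trans (mul_le_mul h2 hF h0 ((norm_nonneg _).trans h2))
  rw [e]
  calc _ ≤ ‖F * M‖ + ‖M * F‖ + ‖F * M * F‖ := norm_add₃_le
    _ ≤ s * ‖M‖ + ‖M‖ * s + s * ‖M‖ * s := by gcongr
    _ = _ := by ring

/-- A small change of the row weights and of the column weights changes the Gram matrix little. -/
lemma norm_gram_rescale_sub_le (X : Matrix n n ℝ)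
    {r₀ r₁ : n → ℝ} {s t c : ℝ} (hs : 0 ≤ s) (ht : 0 ≤ t) (h₀ : ∀ i, |r₀ i ^ 2 - 1| ≤ t)
    (h₁ : ∀ i, |r₁ i - 1| ≤ s) (hX : ‖X‖ ≤ √c) (hc : 0 ≤ c) :
    ‖(Matrix.diagonal r₀ * X * Matrix.diagonal r₁)ᵀ *
        (Matrix.diagonal r₀ * X * Matrix.diagonal r₁) - Xᵀ * X‖ ≤
      (2 * s + s ^ 2 + (1 + s) ^ 2 * t) * c := by
  set F : Matrix n n ℝ := Matrix.diagonal fun i => r₁ i - 1 with hF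
  set G : Matrix n n ℝ := Matrix.diagonal fun i => r₀ i ^ 2 - 1 with hG
  have hFn : ‖F‖ ≤ s := l2_opNorm_diagonal_le hs h₁
  have hGn : ‖G‖ ≤ t := l2_opNorm_diagonal_le ht h₀
  have hR₁ : Matrix.diagonal r₁ = 1 + F := by
    rw [hF, ← Matrix.diagonal_one, Matrix.diagonal_add]
    congr 1; ext i; ring
  have hR₀ : Matrix.diagonal r₀ * Matrix.diagonal r₀ = 1 + G := by
    rw [hG, ← Matrix.diagonal_one, Matrix.diagonal_add, Matrix.diagonal_mul_diagonal]
    congr 1; ext i; ring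
  have hone : ‖(1 : Matrix n n ℝ)‖ ≤ 1 := by
    rw [← Matrix.diagonal_one]
    exact l2_opNorm_diagonal_le zero_le_one (by simp)
  have hR₁n : ‖(1 + F : Matrix n n ℝ)‖ ≤ 1 + s := (norm_add_le _ _).trans (add_le_add hone hFn)
  have hXX : ‖Xᵀ * X‖ ≤ c := by
    refine (norm_mul_le _ _).trans ?_
    rw [l2_opNorm_transpose]
    calc ‖X‖ * ‖X‖ ≤ √c * √c := by gcongr
      _ = c := Real.mul_self_sqrt hc
  have hXGX : ‖Xᵀ * G * X‖ ≤ t * c := by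
    refine (norm_mul_le _ _).trans ?_
    calc ‖Xᵀ * G‖ * ‖X‖ ≤ (√c * t) * √c := by
          gcongr
          refine (norm_mul_le _ _).trans ?_
          rw [l2_opNorm_transpose]
          gcongr
      _ = t * (√c * √c) := by ring
      _ = t * c := by rw [Real.mul_self_sqrt hc]
  -- The two row scalings meet in the middle of the Gram matrix as `1 + G`, so only the squares of
  -- `r₀` have to be close to 1. The column scalings stay outside, which gives the factor `(1 + s) ^
  -- 2` on the `G` term.
  have e : (Matrix.diagonal r₀ * X * Matrix.diagonal r₁)ᵀ *
        (Matrix.diagonal r₀ * X * Matrix.diagonal r₁) - Xᵀ * X =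
      ((1 + F) * (Xᵀ * X) * (1 + F) - Xᵀ * X) + (1 + F) * (Xᵀ * G * X) * (1 + F) := by
    have e1 : (Matrix.diagonal r₀ * X * Matrix.diagonal r₁)ᵀ *
        (Matrix.diagonal r₀ * X * Matrix.diagonal r₁) =
        (1 + F) * (Xᵀ * (1 + G) * X) * (1 + F) := by
      rw [← hR₀, ← hR₁]
      simp only [Matrix.transpose_mul, Matrix.diagonal_transpose, Matrix.mul_assoc]
    rw [e1]
    noncomm_ring
  rw [e]
  refine (norm_add_le _ _).trans ?_
  have h2 : ‖(1 + F) * (Xᵀ * G * X) * (1 + F)‖ ≤ (1 + s) * (t * c) * (1 + s) := by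
    refine (norm_mul_le _ _).trans ?_
    gcongr
    refine (norm_mul_le _ _).trans ?_
    gcongr
  calc _ ≤ (2 * s + s ^ 2) * c + (1 + s) * (t * c) * (1 + s) := by
        gcongr
        exact (norm_conj_sub_le _ _ hFn).trans (by gcongr)
    _ = _ := by ring

/-- A vector orthogonal to the null space is stretched at least by the spectral gap. -/
lemma sq_gap_mul_le {M : Matrix n n ℝ} (hM : M.IsHermitian) {δ : ℝ} (hδ : 0 ≤ δ)
    (hs : ∀ μ ∈ spectrum ℝ M, μ = 0 ∨ δ ≤ μ) (x : n → ℝ)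
    (hx : ∀ v, M *ᵥ v = 0 → v ⬝ᵥ x = 0) :
    δ ^ 2 * ∑ i, x i ^ 2 ≤ ∑ i, (M *ᵥ x) i ^ 2 := by
  -- Parseval in an eigenbasis reduces the claim to single coordinates, each multiplied by its
  -- eigenvalue; those for the eigenvalue 0 vanish by `hx`.
  have hnorm : ∀ y : n → ℝ, ∑ i, y i ^ 2 = ∑ i, ((hM.eigenvectorBasis i).ofLp ⬝ᵥ y) ^ 2 := by
    intro y
    have h := hM.eigenvectorBasis.sum_sq_norm_inner_right (WithLp.toLp 2 y)
    rw [EuclideanSpace.real_norm_sq_eq] at h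
    rw [← h]
    refine Finset.sum_congr rfl fun i _ => ?_
    rw [Real.norm_eq_abs, sq_abs, EuclideanSpace.inner_eq_star_dotProduct]
    simp [dotProduct_comm]
  have hT : Mᵀ = M := by rwa [← Matrix.conjTranspose_eq_transpose_of_trivial]
  rw [hnorm x, hnorm (M *ᵥ x), Finset.mul_sum]
  refine Finset.sum_le_sum fun i _ => ?_
  have h1 : (hM.eigenvectorBasis i).ofLp ⬝ᵥ (M *ᵥ x) =
      hM.eigenvalues i * ((hM.eigenvectorBasis i).ofLp ⬝ᵥ x) := by
    rw [Matrix.dotProduct_mulVec, ← Matrix.mulVec_transpose, hT, hM.mulVec_eigenvectorBasis,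
      smul_dotProduct, smul_eq_mul]
  rw [h1, mul_pow]
  rcases hs _ (hM.eigenvalues_mem_spectrum_real i) with h | h
  · have h2 := hM.mulVec_eigenvectorBasis i
    rw [h, zero_smul] at h2
    rw [hx _ h2]
    simp
  · gcongr

/-- The orthogonal factor of the polar decomposition of a contraction. -/
lemma exists_orthogonal_trace_le {G : Matrix n n ℝ} (hG : ‖G‖ ≤ 1) :
    ∃ O ∈ Matrix.orthogonalGroup n ℝ, (Gᵀ * G).trace ≤ (Oᵀ * G).trace := by
  have hH : (Gᵀ * G).IsHermitian := by
    simpa using Matrix.isHermitian_conjTranspose_mul_self G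
  set B := hH.eigenvectorBasis with hB
  set l := hH.eigenvalues with hl
  have hBB : ∀ i j, (B i).ofLp ⬝ᵥ (B j).ofLp = if i = j then 1 else 0 := by
    intro i j
    have := orthonormal_iff_ite.mp B.orthonormal i j
    rw [EuclideanSpace.inner_eq_star_dotProduct] at this
    rw [dotProduct_comm]
    simpa using this
  have hGG : ∀ i j, (G *ᵥ (B i).ofLp) ⬝ᵥ (G *ᵥ (B j).ofLp) = if i = j then l j else 0 := by
    intro i j
    rw [Matrix.dotProduct_mulVec, ← Matrix.mulVec_transpose, Matrix.mulVec_mulVec,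
      dotProduct_comm, dotProduct_comm, hB, hH.mulVec_eigenvectorBasis, smul_dotProduct, ← hB, hBB]
    by_cases h : i = j <;> simp [h, hl]
  have hl0 : ∀ i, 0 ≤ l i := by
    intro i
    have := hGG i i
    rw [if_pos rfl] at this
    rw [← this]
    exact Finset.sum_nonneg fun _ _ => mul_self_nonneg _
  have hl1 : ∀ i, l i ≤ 1 := by
    intro i
    have h1 := hGG i i
    have h2 := hBB i i
    rw [if_pos rfl] at h1 h2
    have h3 := sum_sq_mulVec_le G (B i).ofLp
    simp only [dotProduct, ← sq] at h1 h2
    rw [h1, h2, mul_one] at h3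
    exact h3.trans (pow_le_one₀ (norm_nonneg _) hG)
  -- Left singular vectors. They are orthonormal for nonzero singular values and are then completed
  -- to a basis `U`; where the singular value is 0, any choice of the basis vector works.
  let v : n → EuclideanSpace ℝ n := fun i => WithLp.toLp 2 ((√(l i))⁻¹ • (G *ᵥ (B i).ofLp))
  have hv : Orthonormal ℝ (({i | l i ≠ 0} : Set n).domRestrict v) := by
    rw [orthonormal_iff_ite]
    rintro ⟨i, hi⟩ ⟨j, hj⟩
    have hij : (⟨i, hi⟩ : {i | l i ≠ 0}) = ⟨j, hj⟩ ↔ i = j := Subtype.mk_eq_mk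
    simp only [Set.domRestrict_apply, v, EuclideanSpace.inner_eq_star_dotProduct, hij]
    rw [dotProduct_comm]
    simp only [star_trivial, smul_dotProduct, dotProduct_smul, hGG, smul_eq_mul]
    by_cases h : i = j
    · subst h
      have h1 : √(l i) ≠ 0 := (Real.sqrt_pos.mpr ((hl0 i).lt_of_ne' hi)).ne'
      rw [if_pos rfl, if_pos rfl]
      field_simp
      exact (Real.sq_sqrt (hl0 i)).symm
    · simp [h]
  obtain ⟨U, hU⟩ := hv.exists_orthonormalBasis_extension_of_card_eq (by simp)
  have hUU : ∀ i j, (U i).ofLp ⬝ᵥ (U j).ofLp = if i = j then 1 else 0 := by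
    intro i j
    have := orthonormal_iff_ite.mp U.orthonormal i j
    rw [EuclideanSpace.inner_eq_star_dotProduct] at this
    rw [dotProduct_comm]
    simpa using this
  have hGU : ∀ i, G *ᵥ (B i).ofLp = √(l i) • (U i).ofLp := by
    intro i
    by_cases h : l i = 0
    · have h1 := hGG i i
      rw [if_pos rfl, h, dotProduct_self_eq_zero] at h1
      simp [h1, h]
    · have h1 : √(l i) ≠ 0 := (Real.sqrt_pos.mpr ((hl0 i).lt_of_ne' h)).ne'
      rw [hU i h]
      simp [v, smul_smul, h1]
  let Bm : Matrix n n ℝ := Matrix.of fun i j => B j i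
  let Um : Matrix n n ℝ := Matrix.of fun i j => U j i
  have hBm : Bmᵀ * Bm = 1 := by
    ext i j
    rw [Matrix.one_apply, ← hBB i j]
    rfl
  have hUm : Umᵀ * Um = 1 := by
    ext i j
    rw [Matrix.one_apply, ← hUU i j]
    rfl
  have hBm' : Bm * Bmᵀ = 1 := mul_eq_one_comm.mp hBm
  have hUm' : Um * Umᵀ = 1 := mul_eq_one_comm.mp hUm
  have hGB : G * Bm = Um * Matrix.diagonal fun i => √(l i) := by
    ext i j
    have := congrFun (hGU j) i
    rw [Matrix.mul_diagonal, mul_comm]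
    exact this
  refine ⟨Um * Bmᵀ, ?_, ?_⟩
  · rw [Matrix.mem_orthogonalGroup_iff, Matrix.transpose_mul, Matrix.transpose_transpose]
    rw [Matrix.mul_assoc, ← Matrix.mul_assoc Bmᵀ, hBm, Matrix.one_mul, hUm']
  · have h1 : ((Um * Bmᵀ)ᵀ * G).trace = ∑ i, √(l i) := by
      rw [Matrix.transpose_mul, Matrix.transpose_transpose, Matrix.mul_assoc, Matrix.trace_mul_comm,
        Matrix.mul_assoc, hGB, ← Matrix.mul_assoc, hUm, Matrix.one_mul, Matrix.trace_diagonal]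
    have h2 : (Gᵀ * G).trace = ∑ i, l i := by
      simpa using hH.trace_eq_sum_eigenvalues
    rw [h1, h2]
    -- The singular values lie in [0, 1], so each one dominates its square.
    refine Finset.sum_le_sum fun i _ => Real.le_sqrt_of_sq_le ?_
    nlinarith [hl0 i, hl1 i]

lemma norm_le_one_of_transpose_mul_self {X : Matrix m n ℝ} (hX : Xᵀ * X = 1) : ‖X‖ ≤ 1 := by
  have h := Matrix.l2_opNorm_conjTranspose_mul_self X
  rw [Matrix.conjTranspose_eq_transpose_of_trivial, hX] at h
  have h1 : ‖(1 : Matrix n n ℝ)‖ ≤ 1 := by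
    rw [← Matrix.diagonal_one]
    exact l2_opNorm_diagonal_le zero_le_one (by simp)
  nlinarith [norm_nonneg X]

/-- **Orthogonal Procrustes problem**: two orthonormal frames can be aligned up to the distance of
the first one from the span of the second one. -/
lemma exists_orthogonal_sum_sq_le [DecidableEq m] {X Z : Matrix m n ℝ} (hX : Xᵀ * X = 1) (hZ : Zᵀ * Z = 1) :
    ∃ O ∈ Matrix.orthogonalGroup n ℝ,
      ∑ i, ∑ j, (X - Z * O) i j ^ 2 ≤ 2 * ∑ i, ∑ j, (X - Z * (Zᵀ * X)) i j ^ 2 := by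
  have hG : ‖Zᵀ * X‖ ≤ 1 := by
    refine (Matrix.l2_opNorm_mul _ _).trans ?_
    rw [l2_opNorm_transpose]
    exact mul_le_one₀ (norm_le_one_of_transpose_mul_self hZ) (norm_nonneg _)
      (norm_le_one_of_transpose_mul_self hX)
  obtain ⟨O, hO, h⟩ := exists_orthogonal_trace_le hG
  refine ⟨O, hO, ?_⟩
  have hO1 : Oᵀ * O = 1 := mul_eq_one_comm.mp ((Matrix.mem_orthogonalGroup_iff _ _).mp hO)
  -- With G = ZᵀX and p columns this gives 2p − 2 tr(OᵀG) for Q = O and p − tr(GᵀG) for Q = G. The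
  -- trace inequality for the polar factor therefore costs exactly the factor 2.
  have key : ∀ Q : Matrix n n ℝ, ((X - Z * Q)ᵀ * (X - Z * Q)).trace =
      (1 : Matrix n n ℝ).trace - 2 * (Qᵀ * (Zᵀ * X)).trace + (Qᵀ * Q).trace := by
    intro Q
    have e1 : (Z * Q)ᵀ * X = Qᵀ * (Zᵀ * X) := by rw [Matrix.transpose_mul, Matrix.mul_assoc]
    have e2 : (Z * Q)ᵀ * (Z * Q) = Qᵀ * Q := by
      rw [Matrix.transpose_mul, Matrix.mul_assoc, ← Matrix.mul_assoc Zᵀ, hZ, Matrix.one_mul]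
    have e3 : (Xᵀ * (Z * Q)).trace = (Qᵀ * (Zᵀ * X)).trace := by
      rw [← Matrix.trace_transpose, Matrix.transpose_mul, Matrix.transpose_transpose, e1]
    rw [Matrix.transpose_sub, Matrix.sub_mul, Matrix.mul_sub, Matrix.mul_sub, hX, e2, e1,
      Matrix.trace_sub, Matrix.trace_sub, Matrix.trace_sub, e3]
    ring
  rw [sum_sq_eq_trace, sum_sq_eq_trace, key, key, hO1]
  linarith

end LinearAlgebra

/-! ### Norms of weighted incidence matrices; blocks of the modified difference -/

section Incidence

open scoped Matrix.Norms.L2Operator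

variable {V : Type*} [Fintype V] [LinearOrder V]

omit [Fintype V] in
-- At most one vertex deletion turns `σ` into `ν`, so the sum has at most one nonzero term, and its
-- sign squares to 1.
lemma incidence_sq (ν σ : Finset V) :
    incidence ν σ ^ 2 = ∑ v ∈ σ, if σ.erase v = ν then (1 : ℝ) else 0 := by
  unfold incidence
  by_cases h : ∃ v ∈ σ, σ.erase v = ν
  · obtain ⟨v, hv, rfl⟩ := h
    have huniq : ∀ u ∈ σ, u ≠ v → ¬ σ.erase u = σ.erase v := fun u hu huv he =>
      huv (Finset.erase_injOn σ hu hv he)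
    rw [Finset.sum_eq_single_of_mem v hv fun u hu huv => if_neg (huniq u hu huv),
      Finset.sum_eq_single_of_mem v hv fun u hu huv => if_neg (huniq u hu huv)]
    simp [← pow_mul, mul_comm]
  · push Not at h
    rw [Finset.sum_eq_zero fun v hv => if_neg (h v hv),
      Finset.sum_eq_zero fun v hv => if_neg (h v hv)]
    simp

omit [Fintype V] in
lemma subset_of_incidence_ne_zero {ν σ : Finset V} (h : incidence ν σ ≠ 0) : ν ⊆ σ := by
  obtain ⟨v, _, hv⟩ := Finset.exists_ne_zero_of_sum_ne_zero h
  have : σ.erase v = ν := by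
    by_contra h'
    exact hv (if_neg h')
  exact this ▸ Finset.erase_subset _ _

/-- The incidence numbers of all simplices, for the orientation `o`. -/
def signedIncidence (o : Finset V → ℤˣ) : Matrix (Finset V) (Finset V) ℝ :=
  Matrix.of fun ν σ => ((o ν : ℤ) : ℝ) * ((o σ : ℤ) : ℝ) * incidence ν σ

omit [Fintype V] in
lemma signedIncidence_sq (o : Finset V → ℤˣ) (ν σ : Finset V) :
    signedIncidence o ν σ ^ 2 = incidence ν σ ^ 2 := by
  have h : ∀ u : ℤˣ, ((u : ℤ) : ℝ) ^ 2 = 1 := fun u => by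
    rcases Int.units_eq_one_or u with rfl | rfl <;> simp
  simp [signedIncidence, mul_pow, h]

omit [Fintype V] in
lemma signedIncidence_eq_zero (o : Finset V → ℤˣ) {ν σ : Finset V} (h : ¬ ν ⊆ σ) :
    signedIncidence o ν σ = 0 := by
  have : incidence ν σ = 0 := by
    by_contra h'
    exact h (subset_of_incidence_ne_zero h')
  simp [signedIncidence, this]

lemma sum_signedIncidence_sq (o : Finset V → ℤˣ) (σ : Finset V) :
    ∑ ν, signedIncidence o ν σ ^ 2 = σ.card := by
  simp_rw [signedIncidence_sq, incidence_sq]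
  rw [Finset.sum_comm]
  simp

/-- The incidence matrix from the simplices in `X` to those in `Y`, with rows scaled by the
inverse square roots of the weights `u` and columns scaled by the square roots of the weights `v`,
and extended by zero to all simplices. -/
def scaledIncidence (o : Finset V → ℤˣ) (Y X : Finset (Finset V)) (u v : Finset V → ℝ) :
    Matrix (Finset V) (Finset V) ℝ :=
  Matrix.of fun ν σ => (if ν ∈ Y then (√(u ν))⁻¹ else 0) * signedIncidence o ν σ *
    (if σ ∈ X then √(v σ) else 0)

/-- Cauchy–Schwarz in the row of `ν`, with √v as one factor, produces the degree of `ν`, which after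
division by `u ν` costs at most `θ`. Summing over the rows then counts the facets of each column
simplex, at most `m` of them. -/
lemma norm_scaledIncidence_sq_le (o : Finset V → ℤˣ) {Y X : Finset (Finset V)}
    {u v : Finset V → ℝ} {m : ℕ} {θ : ℝ} (hθ : 0 ≤ θ) (hX : ∀ σ ∈ X, σ.card = m)
    (hv : ∀ σ ∈ X, 0 ≤ v σ) (hu : ∀ ν ∈ Y, 0 < u ν) (h : ∀ ν ∈ Y, degree X v ν ≤ θ * u ν) :
    ‖scaledIncidence o Y X u v‖ ^ 2 ≤ θ * m := by
  refine l2_opNorm_sq_le _ (by positivity) fun x => ?_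
  set C := signedIncidence o with hC
  have hrow : ∀ ν, (scaledIncidence o Y X u v *ᵥ x) ν ^ 2 ≤
      θ * ∑ σ ∈ X, C ν σ ^ 2 * x σ ^ 2 := by
    intro ν
    by_cases hν : ν ∈ Y
    · have hs : (scaledIncidence o Y X u v *ᵥ x) ν =
          (√(u ν))⁻¹ * ∑ σ ∈ X, (if ν ⊆ σ then √(v σ) else 0) * (C ν σ * x σ) := by
        simp only [scaledIncidence, Matrix.mulVec, dotProduct, Matrix.of_apply, if_pos hν]
        rw [Finset.mul_sum, ← Finset.sum_subset (Finset.subset_univ X)]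
        · refine Finset.sum_congr rfl fun σ hσ => ?_
          by_cases hs : ν ⊆ σ
          · rw [if_pos hσ, if_pos hs]; ring
          · rw [hC, signedIncidence_eq_zero o hs]; ring
        · intro σ _ hσ
          rw [if_neg hσ]; ring
      have hd : ∑ σ ∈ X, (if ν ⊆ σ then √(v σ) else 0) ^ 2 = degree X v ν := by
        rw [degree, Finset.sum_filter]
        refine Finset.sum_congr rfl fun σ hσ => ?_
        split_ifs
        · exact Real.sq_sqrt (hv σ hσ)
        · simp
      have hcs := Finset.sum_mul_sq_le_sq_mul_sq X (fun σ => if ν ⊆ σ then √(v σ) else 0)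
        fun σ => C ν σ * x σ
      rw [hd] at hcs
      have hnn : 0 ≤ ∑ σ ∈ X, (C ν σ * x σ) ^ 2 := Finset.sum_nonneg fun _ _ => sq_nonneg _
      rw [hs, mul_pow, inv_pow, Real.sq_sqrt (hu ν hν).le]
      calc (u ν)⁻¹ * (∑ σ ∈ X, (if ν ⊆ σ then √(v σ) else 0) * (C ν σ * x σ)) ^ 2
          ≤ (u ν)⁻¹ * ((θ * u ν) * ∑ σ ∈ X, (C ν σ * x σ) ^ 2) :=
            mul_le_mul_of_nonneg_left (hcs.trans (mul_le_mul_of_nonneg_right (h ν hν) hnn))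
              (inv_nonneg.mpr (hu ν hν).le)
        _ = θ * ∑ σ ∈ X, C ν σ ^ 2 * x σ ^ 2 := by
            have := (hu ν hν).ne'
            simp_rw [mul_pow]
            field_simp
    · have hs : (scaledIncidence o Y X u v *ᵥ x) ν = 0 := by
        simp [scaledIncidence, Matrix.mulVec, dotProduct, hν]
      rw [hs]
      have : 0 ≤ ∑ σ ∈ X, C ν σ ^ 2 * x σ ^ 2 := Finset.sum_nonneg fun _ _ => by positivity
      simpa using mul_nonneg hθ this
  calc ∑ ν, (scaledIncidence o Y X u v *ᵥ x) ν ^ 2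
      ≤ ∑ ν, θ * ∑ σ ∈ X, C ν σ ^ 2 * x σ ^ 2 := Finset.sum_le_sum fun ν _ => hrow ν
    _ = θ * ∑ σ ∈ X, m * x σ ^ 2 := by
        rw [← Finset.mul_sum, Finset.sum_comm]
        congr 1
        refine Finset.sum_congr rfl fun σ hσ => ?_
        rw [← Finset.sum_mul, sum_signedIncidence_sq, hX σ hσ]
    _ ≤ θ * ∑ σ, m * x σ ^ 2 := by
        refine mul_le_mul_of_nonneg_left ?_ hθ
        exact Finset.sum_le_sum_of_subset_of_nonneg (Finset.subset_univ X)
          fun _ _ _ => by positivity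
    _ = θ * m * ∑ σ, x σ ^ 2 := by rw [← Finset.mul_sum, mul_assoc]

lemma norm_scaledIncidence_le (o : Finset V → ℤˣ) {Y X : Finset (Finset V)}
    {u v : Finset V → ℝ} {m : ℕ} {θ : ℝ} (hθ : 0 ≤ θ) (hX : ∀ σ ∈ X, σ.card = m)
    (hv : ∀ σ ∈ X, 0 ≤ v σ) (hu : ∀ ν ∈ Y, 0 < u ν) (h : ∀ ν ∈ Y, degree X v ν ≤ θ * u ν) :
    ‖scaledIncidence o Y X u v‖ ≤ √θ * √m := by
  rw [← Real.sqrt_mul hθ]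
  exact l2_opNorm_le_of_sq_le (norm_scaledIncidence_sq_le o hθ hX hv hu h)

/-- The entries of `L` with row in `X` and column in `Y`, extended by zero. -/
def mask (X Y : Finset (Finset V)) (L : Matrix (Finset V) (Finset V) ℝ) :
    Matrix (Finset V) (Finset V) ℝ :=
  Matrix.of fun σ τ => if σ ∈ X ∧ τ ∈ Y then L σ τ else 0

lemma norm_mask_swap (X Y : Finset (Finset V)) {L : Matrix (Finset V) (Finset V) ℝ}
    (hL : Lᵀ = L) : ‖mask Y X L‖ = ‖mask X Y L‖ := by
  rw [← l2_opNorm_transpose (mask X Y L)]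
  congr 1
  ext σ τ
  conv_lhs => rw [← hL]
  simp [mask, and_comm]

/-- The blocks on `S \ T` and on `T \ S` are the same in both extensions and cancel, and `S \ T` is
not coupled to `T \ S`. The factors 2 account for each coupling and its transpose. -/
lemma specNorm_modDiff_le {S T : Finset (Finset V)} {M : Matrix S S ℝ} {M' : Matrix T T ℝ}
    {L L' : Matrix (Finset V) (Finset V) ℝ} (hM : ∀ σ τ : S, M σ τ = L σ τ)
    (hM' : ∀ σ τ : T, M' σ τ = L' σ τ) (hL : Lᵀ = L) (hL' : L'ᵀ = L') :
    specNorm (modDiff S T M M') ≤ ‖mask (S ∩ T) (S ∩ T) L - mask (S ∩ T) (S ∩ T) L'‖ +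
      2 * ‖mask (S ∩ T) (S \ T) L‖ + 2 * ‖mask (S ∩ T) (T \ S) L'‖ := by
  set E : Matrix (Finset V) (Finset V) ℝ := (mask (S ∩ T) (S ∩ T) L - mask (S ∩ T) (S ∩ T) L') +
    (mask (S ∩ T) (S \ T) L + mask (S \ T) (S ∩ T) L) -
    (mask (S ∩ T) (T \ S) L' + mask (T \ S) (S ∩ T) L') with hE
  have h1 : modDiff S T M M' = E.submatrix Subtype.val Subtype.val := by
    ext ⟨σ, hσ⟩ ⟨τ, hτ⟩
    rw [Finset.mem_union] at hσ hτ
    simp only [modDiff, glue, Matrix.of_apply, Matrix.submatrix_apply, hE, Matrix.add_apply,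
      Matrix.sub_apply, mask, Finset.mem_inter, Finset.mem_sdiff, hM, hM']
    by_cases h1 : σ ∈ S <;> by_cases h2 : σ ∈ T <;> by_cases h3 : τ ∈ S <;> by_cases h4 : τ ∈ T <;>
      simp_all
  have h2 : specNorm (modDiff S T M M') ≤ ‖E‖ := by
    rw [h1]
    exact l2_opNorm_submatrix_le E Subtype.val_injective
  refine h2.trans ?_
  rw [hE]
  refine (norm_sub_le _ _).trans ?_
  have h3 := norm_add_le (mask (S ∩ T) (S \ T) L) (mask (S \ T) (S ∩ T) L)
  have h4 := norm_add_le (mask (S ∩ T) (T \ S) L') (mask (T \ S) (S ∩ T) L')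
  rw [norm_mask_swap (S ∩ T) (S \ T) hL] at h3
  rw [norm_mask_swap (S ∩ T) (T \ S) hL'] at h4
  have h5 := norm_add_le (mask (S ∩ T) (S ∩ T) L - mask (S ∩ T) (S ∩ T) L')
    (mask (S ∩ T) (S \ T) L + mask (S \ T) (S ∩ T) L)
  linarith

end Incidence

/-! ### Perturbation bounds for the down and up Laplacians -/

section Perturbation

open scoped Matrix.Norms.L2Operator

variable {V : Type*} [Fintype V] [LinearOrder V] {K K' : PreAbstractSimplicialComplex V}

omit [LinearOrder V] in
lemma mem_cells {m : ℕ} {σ : Finset V} : σ ∈ cells K m ↔ σ ∈ K ∧ σ.card = m := by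
  simp [cells]

omit [Fintype V] [LinearOrder V] in
lemma mem_of_subset {σ ν : Finset V} (hσ : σ ∈ K) (hν : ν.Nonempty) (h : ν ⊆ σ) : ν ∈ K :=
  (K.isRelLowerSet_faces hσ).2 h hν

omit [Fintype V] [LinearOrder V] in
lemma nonempty_of_mem {σ : Finset V} (hσ : σ ∈ K) : σ.Nonempty :=
  (K.isRelLowerSet_faces hσ).1

omit [LinearOrder V] in
-- Complexes are closed only under nonempty faces; membership in a cell set of `K` supplies the
-- nonemptiness.
lemma mem_cells_of_subset {m n : ℕ} {ν σ : Finset V} (hν : ν ∈ cells K m) (hσ : σ ∈ cells K' n)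
    (h : ν ⊆ σ) : ν ∈ cells K' m := by
  rw [mem_cells] at hν hσ ⊢
  exact ⟨mem_of_subset hσ.1 (nonempty_of_mem hν.1) h, hν.2⟩

lemma normBoundary_apply (o : Finset V → ℤˣ) (m : ℕ) (u v : Finset V → ℝ) (ν : cells K m)
    (σ : cells K (m + 1)) : normBoundary K o m u v ν σ =
      scaledIncidence o (cells K m) (cells K (m + 1)) u v ν σ := by
  rw [normBoundary, Matrix.mul_diagonal, Matrix.diagonal_mul]
  simp [boundary, scaledIncidence, signedIncidence]

/-- The down Laplacian, extended by zero to all simplices. -/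
def fullDown (K : PreAbstractSimplicialComplex V) (o : Finset V → ℤˣ) (k : ℕ) (w : Finset V → ℝ) :
    Matrix (Finset V) (Finset V) ℝ :=
  (scaledIncidence o (cells K k) (cells K (k + 1)) (weightLow K k w) (weightMid K k w))ᵀ *
    scaledIncidence o (cells K k) (cells K (k + 1)) (weightLow K k w) (weightMid K k w)

/-- The up Laplacian, extended by zero to all simplices. -/
def fullUp (K : PreAbstractSimplicialComplex V) (o : Finset V → ℤˣ) (k : ℕ) (w : Finset V → ℝ) :
    Matrix (Finset V) (Finset V) ℝ :=
  scaledIncidence o (cells K (k + 1)) (cells K (k + 2)) (weightMid K k w) w *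
    (scaledIncidence o (cells K (k + 1)) (cells K (k + 2)) (weightMid K k w) w)ᵀ

lemma fullDown_transpose (o : Finset V → ℤˣ) (k : ℕ) (w : Finset V → ℝ) :
    (fullDown K o k w)ᵀ = fullDown K o k w := by
  simp [fullDown]

lemma fullUp_transpose (o : Finset V → ℤˣ) (k : ℕ) (w : Finset V → ℝ) :
    (fullUp K o k w)ᵀ = fullUp K o k w := by
  simp [fullUp]

lemma downLaplacian_apply (o : Finset V → ℤˣ) (k : ℕ) (w : Finset V → ℝ)
    (σ τ : cells K (k + 1)) : downLaplacian K o k w σ τ = fullDown K o k w σ τ := by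
  simp only [downLaplacian, matA, fullDown, Matrix.mul_apply, Matrix.transpose_apply,
    normBoundary_apply]
  set A := scaledIncidence o (cells K k) (cells K (k + 1)) (weightLow K k w) (weightMid K k w)
    with hA
  refine (Finset.sum_coe_sort (cells K k) fun ν => A ν σ * A ν τ).trans
    (Finset.sum_subset (Finset.subset_univ _) fun ν _ hν => ?_)
  simp [hA, scaledIncidence, hν]

lemma upLaplacian_apply (o : Finset V → ℤˣ) (k : ℕ) (w : Finset V → ℝ)
    (σ τ : cells K (k + 1)) : upLaplacian K o k w σ τ = fullUp K o k w σ τ := by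
  simp only [upLaplacian, matA', fullUp, Matrix.mul_apply, Matrix.transpose_apply,
    normBoundary_apply]
  set A := scaledIncidence o (cells K (k + 1)) (cells K (k + 2)) (weightMid K k w) w with hA
  refine (Finset.sum_coe_sort (cells K (k + 2)) fun ν => A σ ν * A τ ν).trans
    (Finset.sum_subset (Finset.subset_univ _) fun ν _ hν => ?_)
  simp [hA, scaledIncidence, hν]

/-- Entries couple simplices through shared faces, and a face of a common simplex is itself common.
-/
lemma mask_fullDown (o : Finset V → ℤˣ) (k : ℕ) (w : Finset V → ℝ) {X : Finset (Finset V)}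
    (hX : X ⊆ cells K (k + 1)) :
    mask (cells K (k + 1) ∩ cells K' (k + 1)) X (fullDown K o k w) =
      (scaledIncidence o (cells K k ∩ cells K' k) (cells K (k + 1) ∩ cells K' (k + 1))
        (weightLow K k w) (weightMid K k w))ᵀ *
      scaledIncidence o (cells K k ∩ cells K' k) X (weightLow K k w) (weightMid K k w) := by
  ext σ τ
  simp only [mask, fullDown, Matrix.of_apply, Matrix.mul_apply, Matrix.transpose_apply,
    scaledIncidence]
  by_cases h : σ ∈ cells K (k + 1) ∩ cells K' (k + 1) ∧ τ ∈ X
  · rw [if_pos h]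
    obtain ⟨hσ, hτ⟩ := h
    have hσ' := Finset.mem_inter.mp hσ
    refine Finset.sum_congr rfl fun ν _ => ?_
    rw [if_pos hσ'.1, if_pos hσ, if_pos (hX hτ), if_pos hτ]
    by_cases hνσ : ν ⊆ σ
    · by_cases hν : ν ∈ cells K k
      · simp [hν, mem_cells_of_subset hν hσ'.2 hνσ]
      · simp [hν]
    · simp [signedIncidence_eq_zero o hνσ]
  · rw [if_neg h]
    refine (Finset.sum_eq_zero fun ν _ => ?_).symm
    rcases not_and_or.mp h with h | h <;> simp [h]

lemma mask_fullUp (o : Finset V → ℤˣ) (k : ℕ) (w : Finset V → ℝ) {X Y : Finset (Finset V)}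
    (hX : X ⊆ cells K (k + 1)) (hY : Y ⊆ cells K (k + 1)) :
    mask X Y (fullUp K o k w) =
      scaledIncidence o X (cells K (k + 2)) (weightMid K k w) w *
      (scaledIncidence o Y (cells K (k + 2)) (weightMid K k w) w)ᵀ := by
  ext σ τ
  simp only [mask, fullUp, Matrix.of_apply, Matrix.mul_apply, Matrix.transpose_apply,
    scaledIncidence]
  by_cases h : σ ∈ X ∧ τ ∈ Y
  · rw [if_pos h, if_pos (hX h.1), if_pos h.1, if_pos (hY h.2), if_pos h.2]
  · rw [if_neg h]
    refine (Finset.sum_eq_zero fun ν _ => ?_).symm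
    rcases not_and_or.mp h with h | h <;> simp [h]

/-- A coface of a created simplex is created, since otherwise its face would lie in `K'`. So both
factors involve created `(k+1)`-simplices only, and the one with rows in `X` can be made small. -/
lemma mask_fullUp_created (o : Finset V → ℤˣ) (k : ℕ) (w : Finset V → ℝ)
    {X : Finset (Finset V)} (hX : X ⊆ cells K (k + 1)) :
    mask X (cells K (k + 1) \ cells K' (k + 1)) (fullUp K o k w) =
      scaledIncidence o X (cells K (k + 2) \ cells K' (k + 2)) (weightMid K k w) w *
      (scaledIncidence o (cells K (k + 1) \ cells K' (k + 1))
        (cells K (k + 2) \ cells K' (k + 2)) (weightMid K k w) w)ᵀ := by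
  rw [mask_fullUp o k w hX Finset.sdiff_subset]
  ext σ τ
  simp only [Matrix.mul_apply, Matrix.transpose_apply, scaledIncidence, Matrix.of_apply]
  refine Finset.sum_congr rfl fun ρ _ => ?_
  by_cases hτ : τ ∈ cells K (k + 1) \ cells K' (k + 1)
  · by_cases hτρ : τ ⊆ ρ
    · have hρ' : ρ ∉ cells K' (k + 2) := fun hρ => by
        rw [Finset.mem_sdiff] at hτ
        exact hτ.2 (mem_cells_of_subset hτ.1 hρ hτρ)
      simp [hρ']
    · simp [signedIncidence_eq_zero o hτρ]
  · simp [hτ]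

/-- The product is a sum over columns, so disjoint sets of columns contribute without cross terms.
-/
lemma scaledIncidence_mul_transpose_split (o : Finset V → ℤˣ) (Y S T : Finset (Finset V))
    (u v : Finset V → ℝ) :
    scaledIncidence o Y S u v * (scaledIncidence o Y S u v)ᵀ =
      scaledIncidence o Y (S ∩ T) u v * (scaledIncidence o Y (S ∩ T) u v)ᵀ +
      scaledIncidence o Y (S \ T) u v * (scaledIncidence o Y (S \ T) u v)ᵀ := by
  ext σ τ
  simp only [Matrix.mul_apply, Matrix.transpose_apply, scaledIncidence, Matrix.of_apply,
    Matrix.add_apply, ← Finset.sum_add_distrib]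
  refine Finset.sum_congr rfl fun ρ _ => ?_
  by_cases h1 : ρ ∈ S <;> by_cases h2 : ρ ∈ T <;> simp [h1, h2]

omit [Fintype V] in
lemma degree_mono {S T : Finset (Finset V)} {v v' : Finset V → ℝ} (hST : S ⊆ T)
    (h : ∀ σ ∈ S, v σ ≤ v' σ) (hv' : ∀ σ ∈ T, 0 ≤ v' σ) (ν : Finset V) :
    degree S v ν ≤ degree T v' ν := by
  refine (Finset.sum_le_sum fun σ hσ => h σ (Finset.mem_filter.mp hσ).1).trans ?_
  exact Finset.sum_le_sum_of_subset_of_nonneg (Finset.filter_subset_filter _ hST)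
    fun σ hσ _ => hv' σ (Finset.mem_filter.mp hσ).1

omit [Fintype V] in
lemma degree_congr {S : Finset (Finset V)} {v v' : Finset V → ℝ} (h : ∀ σ ∈ S, v σ = v' σ) :
    degree S v = degree S v' := by
  ext ν
  exact Finset.sum_congr rfl fun σ hσ => h σ (Finset.mem_filter.mp hσ).1

omit [Fintype V] in
/-- If passing to smaller weights on `S ∩ T` changes the degree little, then `S \ T` contributes
little to the degree. -/
lemma degree_sdiff_le {S T : Finset (Finset V)} {v v' : Finset V → ℝ} {ν : Finset V} {e : ℝ}
    (he : 0 ≤ e) (hv : ∀ σ ∈ S, 0 ≤ v σ) (h : ∀ σ ∈ S ∩ T, v' σ ≤ v σ)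
    (hpos : 0 < degree (S ∩ T) v' ν) (hle : degree S v ν / degree (S ∩ T) v' ν - 1 ≤ e) :
    degree (S \ T) v ν ≤ e * degree S v ν := by
  have h1 : degree S v ν = degree (S ∩ T) v ν + degree (S \ T) v ν := by
    simp only [degree, Finset.sum_filter]
    exact (Finset.sum_inter_add_sum_sdiff S T _).symm
  have h2 : degree (S ∩ T) v' ν ≤ degree (S ∩ T) v ν :=
    degree_mono subset_rfl h (fun σ hσ => hv σ (Finset.mem_inter.mp hσ).1) ν
  have h3 : degree (S ∩ T) v' ν ≤ degree S v ν := degree_mono Finset.inter_subset_left h hv ν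
  have h4 : degree S v ν ≤ (e + 1) * degree (S ∩ T) v' ν := by
    rw [← div_le_iff₀ hpos]; linarith
  -- With d, a, b the degrees over S, S ∩ T, S \ T for `v` and c the one over S ∩ T for `v'`: b = d
  -- − a ≤ d − c ≤ e c ≤ e d.
  nlinarith [mul_le_mul_of_nonneg_left h3 he]

/-- The reduced weights are symmetric in the two complexes, so destroyed simplices are handled as
the created ones with the roles exchanged. -/
lemma commonMid_swap {k : ℕ} {w w' : Finset V → ℝ} (h : ∀ τ ∈ common K K' (k + 2), w' τ = w τ) :
    commonMid K' K k w' = commonMid K K' k w := by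
  rw [commonMid, commonMid, common, Finset.inter_comm]
  exact degree_congr h

lemma commonLow_swap {k : ℕ} {w w' : Finset V → ℝ} (h : ∀ τ ∈ common K K' (k + 2), w' τ = w τ) :
    commonLow K' K k w' = commonLow K K' k w := by
  rw [commonLow, commonLow, commonMid_swap h, common, Finset.inter_comm]
  rfl

variable {o : Finset V → ℤˣ} {k : ℕ} {w w' : Finset V → ℝ} {e : ℝ}

lemma commonMid_le_weightMid (hw : ValidWeights K k w) (σ : Finset V) :
    commonMid K K' k w σ ≤ weightMid K k w σ :=
  degree_mono Finset.inter_subset_left (fun _ _ => le_rfl) hw.top_nonneg σ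

lemma degree_created_mid_le (he : 0 ≤ e) (hw : ValidWeights K k w) {σ : Finset V}
    (hpos : 0 < commonMid K K' k w σ) (h : weightMid K k w σ / commonMid K K' k w σ - 1 ≤ e) :
    degree (cells K (k + 2) \ cells K' (k + 2)) w σ ≤ e * weightMid K k w σ :=
  degree_sdiff_le he hw.top_nonneg (fun _ _ => le_rfl) hpos h

lemma degree_created_low_le (he : 0 ≤ e) (hw : ValidWeights K k w) {ν : Finset V}
    (hpos : 0 < commonLow K K' k w ν) (h : weightLow K k w ν / commonLow K K' k w ν - 1 ≤ e) :
    degree (cells K (k + 1) \ cells K' (k + 1)) (weightMid K k w) ν ≤ e * weightLow K k w ν :=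
  degree_sdiff_le he (fun σ hσ => (hw.mid_pos σ hσ).le)
    (fun σ _ => commonMid_le_weightMid hw σ) hpos h

lemma norm_scaledIncidence_low_le (he : 0 ≤ e) (hw : ValidWeights K k w)
    {Y X : Finset (Finset V)} (hX : X ⊆ cells K (k + 1)) (hY : Y ⊆ cells K k)
    (h : ∀ ν ∈ Y, degree X (weightMid K k w) ν ≤ e * weightLow K k w ν) :
    ‖scaledIncidence o Y X (weightLow K k w) (weightMid K k w)‖ ≤ √e * √((k : ℝ) + 1) := by
  have := norm_scaledIncidence_le o (m := k + 1) he (fun σ hσ => (mem_cells.mp (hX hσ)).2)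
    (fun σ hσ => (hw.mid_pos σ (hX hσ)).le) (fun ν hν => hw.low_pos ν (hY hν)) h
  exact_mod_cast this

lemma norm_scaledIncidence_mid_le (he : 0 ≤ e) (hw : ValidWeights K k w)
    {Y X : Finset (Finset V)} (hX : X ⊆ cells K (k + 2)) (hY : Y ⊆ cells K (k + 1))
    (h : ∀ ν ∈ Y, degree X w ν ≤ e * weightMid K k w ν) :
    ‖scaledIncidence o Y X (weightMid K k w) w‖ ≤ √e * √((k : ℝ) + 2) := by
  have := norm_scaledIncidence_le o (m := k + 2) he (fun σ hσ => (mem_cells.mp (hX hσ)).2)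
    (fun σ hσ => hw.top_nonneg σ (hX hσ)) (fun ν hν => hw.mid_pos ν (hY hν)) h
  exact_mod_cast this

lemma norm_scaledIncidence_low_le_sqrt (hw : ValidWeights K k w)
    {Y X : Finset (Finset V)} (hX : X ⊆ cells K (k + 1)) (hY : Y ⊆ cells K k) :
    ‖scaledIncidence o Y X (weightLow K k w) (weightMid K k w)‖ ≤ √((k : ℝ) + 1) := by
  have := norm_scaledIncidence_low_le (o := o) zero_le_one hw hX hY fun ν _ => by
    rw [one_mul]
    exact degree_mono hX (fun _ _ => le_rfl) (fun σ hσ => (hw.mid_pos σ hσ).le) ν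
  simpa using this

lemma norm_scaledIncidence_mid_le_sqrt (hw : ValidWeights K k w)
    {Y X : Finset (Finset V)} (hX : X ⊆ cells K (k + 2)) (hY : Y ⊆ cells K (k + 1)) :
    ‖scaledIncidence o Y X (weightMid K k w) w‖ ≤ √((k : ℝ) + 2) := by
  have := norm_scaledIncidence_mid_le (o := o) zero_le_one hw hX hY fun ν _ => by
    rw [one_mul]
    exact degree_mono hX (fun _ _ => le_rfl) hw.top_nonneg ν
  simpa using this

/-- The coupling of the common and the created `k`-simplices in the down Laplacian. -/
lemma norm_mask_fullDown_created_le (he : 0 ≤ e) (hw : ValidWeights K k w)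
    (hpos : ∀ ν ∈ common K K' k, 0 < commonLow K K' k w ν)
    (h : ∀ ν ∈ common K K' k, weightLow K k w ν / commonLow K K' k w ν - 1 ≤ e) :
    ‖mask (cells K (k + 1) ∩ cells K' (k + 1)) (cells K (k + 1) \ cells K' (k + 1))
      (fullDown K o k w)‖ ≤ √e * ((k : ℝ) + 1) := by
  rw [mask_fullDown o k w Finset.sdiff_subset]
  refine (norm_mul_le _ _).trans ?_
  rw [l2_opNorm_transpose]
  calc _ ≤ √((k : ℝ) + 1) * (√e * √((k : ℝ) + 1)) := by
        refine mul_le_mul ?_ ?_ (norm_nonneg _) (Real.sqrt_nonneg _)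
        · exact norm_scaledIncidence_low_le_sqrt hw Finset.inter_subset_left
            Finset.inter_subset_left
        · exact norm_scaledIncidence_low_le he hw Finset.sdiff_subset Finset.inter_subset_left
            fun ν hν => degree_created_low_le he hw (hpos ν hν) (h ν hν)
    _ = √e * (√((k : ℝ) + 1) * √((k : ℝ) + 1)) := by ring
    _ = _ := by rw [Real.mul_self_sqrt (by positivity)]

/-- The coupling of the common and the created `k`-simplices in the up Laplacian. -/
lemma norm_mask_fullUp_created_le (he : 0 ≤ e) (hw : ValidWeights K k w)
    (hpos : ∀ σ ∈ common K K' (k + 1), 0 < commonMid K K' k w σ)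
    (h : ∀ σ ∈ common K K' (k + 1), weightMid K k w σ / commonMid K K' k w σ - 1 ≤ e) :
    ‖mask (cells K (k + 1) ∩ cells K' (k + 1)) (cells K (k + 1) \ cells K' (k + 1))
      (fullUp K o k w)‖ ≤ √e * ((k : ℝ) + 2) := by
  rw [mask_fullUp_created o k w Finset.inter_subset_left]
  refine (norm_mul_le _ _).trans ?_
  rw [l2_opNorm_transpose]
  calc _ ≤ (√e * √((k : ℝ) + 2)) * √((k : ℝ) + 2) := by
        refine mul_le_mul ?_ ?_ (norm_nonneg _) (by positivity)
        · exact norm_scaledIncidence_mid_le he hw Finset.sdiff_subset Finset.inter_subset_left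
            fun σ hσ => degree_created_mid_le he hw (hpos σ hσ) (h σ hσ)
        · exact norm_scaledIncidence_mid_le_sqrt hw Finset.sdiff_subset Finset.sdiff_subset
    _ = √e * (√((k : ℝ) + 2) * √((k : ℝ) + 2)) := by ring
    _ = _ := by rw [Real.mul_self_sqrt (by positivity)]

/-- The contribution of the created `(k+1)`-simplices to the up Laplacian on common simplices. -/
lemma norm_up_created_le (he : 0 ≤ e) (hw : ValidWeights K k w)
    (hpos : ∀ σ ∈ common K K' (k + 1), 0 < commonMid K K' k w σ)
    (h : ∀ σ ∈ common K K' (k + 1), weightMid K k w σ / commonMid K K' k w σ - 1 ≤ e) :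
    ‖scaledIncidence o (cells K (k + 1) ∩ cells K' (k + 1))
        (cells K (k + 2) \ cells K' (k + 2)) (weightMid K k w) w *
      (scaledIncidence o (cells K (k + 1) ∩ cells K' (k + 1))
        (cells K (k + 2) \ cells K' (k + 2)) (weightMid K k w) w)ᵀ‖ ≤ e * ((k : ℝ) + 2) := by
  have h1 : ‖scaledIncidence o (cells K (k + 1) ∩ cells K' (k + 1))
      (cells K (k + 2) \ cells K' (k + 2)) (weightMid K k w) w‖ ≤ √e * √((k : ℝ) + 2) :=
    norm_scaledIncidence_mid_le he hw Finset.sdiff_subset Finset.inter_subset_left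
      fun σ hσ => degree_created_mid_le he hw (hpos σ hσ) (h σ hσ)
  refine (norm_mul_le _ _).trans ?_
  rw [l2_opNorm_transpose]
  calc _ ≤ (√e * √((k : ℝ) + 2)) * (√e * √((k : ℝ) + 2)) := by gcongr
    _ = (√e * √e) * (√((k : ℝ) + 2) * √((k : ℝ) + 2)) := by ring
    _ = _ := by rw [Real.mul_self_sqrt he, Real.mul_self_sqrt (by positivity)]

/-- The value 1 off `Y` and `X` is harmless, as those rows and columns vanish, and there the scaling
does not deviate from 1. -/
lemma scaledIncidence_rescale (o : Finset V → ℤˣ) {Y X : Finset (Finset V)}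
    {u v u' v' : Finset V → ℝ} (hu' : ∀ ν ∈ Y, 0 < u' ν) (hv' : ∀ σ ∈ X, 0 < v' σ) :
    scaledIncidence o Y X u v =
      Matrix.diagonal (fun ν => if ν ∈ Y then √(u' ν) / √(u ν) else 1) *
        scaledIncidence o Y X u' v' *
        Matrix.diagonal (fun σ => if σ ∈ X then √(v σ) / √(v' σ) else 1) := by
  ext ν σ
  rw [Matrix.mul_diagonal, Matrix.diagonal_mul]
  simp only [scaledIncidence, Matrix.of_apply]
  by_cases hν : ν ∈ Y
  swap
  · simp [hν]
  by_cases hσ : σ ∈ X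
  swap
  · simp [hσ]
  simp only [if_pos hν, if_pos hσ]
  have h1 := (Real.sqrt_pos.mpr (hu' ν hν)).ne'
  have h2 := (Real.sqrt_pos.mpr (hv' σ hσ)).ne'
  field_simp

section Main

variable {e₀ e' e₀' : ℝ}

/-- The term 4√ε₀ collects the created and the destroyed coupling, each counted twice; the other
terms come from rescaling the rows and columns on common simplices. -/
theorem specNorm_diffDown_le (hw : ValidWeights K k w) (hw' : ValidWeights K' k w')
    (hagree : ∀ τ ∈ common K K' (k + 2), w' τ = w τ)
    (hlow : ∀ ν ∈ common K K' k, 0 < commonLow K K' k w ν)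
    (he₀ : 0 ≤ e₀) (he' : 0 ≤ e')
    (hsmall : SmallWeightChange (common K K' (k + 1)) (common K K' k)
      (weightMid K k w) (weightMid K' k w') (commonMid K K' k w)
      (weightLow K k w) (weightLow K' k w') (commonLow K K' k w) e e₀ e' e₀') :
    specNorm (diffDown K K' o k w w') ≤
      (2 * √e' + e' + (1 + √e') ^ 2 * √e₀' + 4 * √e₀) * ((k : ℝ) + 1) := by
  have h1 := norm_mask_fullDown_created_le (o := o) he₀ hw hlow hsmall.created_low
  have h2 : ‖mask (cells K (k + 1) ∩ cells K' (k + 1)) (cells K' (k + 1) \ cells K (k + 1))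
      (fullDown K' o k w')‖ ≤ √e₀ * ((k : ℝ) + 1) := by
    rw [Finset.inter_comm]
    apply norm_mask_fullDown_created_le he₀ hw'
    · rw [common, Finset.inter_comm, commonLow_swap hagree]
      exact hlow
    · rw [common, Finset.inter_comm, commonLow_swap hagree]
      exact hsmall.destroyed_low
  have h3 : ‖mask (cells K (k + 1) ∩ cells K' (k + 1)) (cells K (k + 1) ∩ cells K' (k + 1))
        (fullDown K o k w) -
      mask (cells K (k + 1) ∩ cells K' (k + 1)) (cells K (k + 1) ∩ cells K' (k + 1))
        (fullDown K' o k w')‖ ≤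
      (2 * √e' + √e' ^ 2 + (1 + √e') ^ 2 * √e₀') * ((k : ℝ) + 1) := by
    have e1 : mask (cells K (k + 1) ∩ cells K' (k + 1)) (cells K (k + 1) ∩ cells K' (k + 1))
        (fullDown K' o k w') =
      (scaledIncidence o (cells K k ∩ cells K' k) (cells K (k + 1) ∩ cells K' (k + 1))
        (weightLow K' k w') (weightMid K' k w'))ᵀ *
      scaledIncidence o (cells K k ∩ cells K' k) (cells K (k + 1) ∩ cells K' (k + 1))
        (weightLow K' k w') (weightMid K' k w') := by
      rw [Finset.inter_comm, Finset.inter_comm (cells K k)]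
      exact mask_fullDown o k w' Finset.inter_subset_left
    have hu' : ∀ ν ∈ cells K k ∩ cells K' k, 0 < weightLow K' k w' ν := fun ν hν =>
      hw'.low_pos ν (Finset.mem_inter.mp hν).2
    rw [e1, mask_fullDown o k w Finset.inter_subset_left, scaledIncidence_rescale o hu'
      (fun σ hσ => hw'.mid_pos σ (Finset.mem_inter.mp hσ).2)]
    refine norm_gram_rescale_sub_le _ (Real.sqrt_nonneg _) (Real.sqrt_nonneg _) (fun ν => ?_)
      (fun σ => ?_) (norm_scaledIncidence_low_le_sqrt hw' Finset.inter_subset_right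
        Finset.inter_subset_right) (by positivity)
    · by_cases hν : ν ∈ cells K k ∩ cells K' k
      · have hp := hw.low_pos ν (Finset.mem_inter.mp hν).1
        have := hsmall.net_low_inv ν hν
        -- The squared row scaling is û/u, so the bound with √ε'ₖ₋₁ applies to it directly.
        rw [if_pos hν, div_pow, Real.sq_sqrt (hu' ν hν).le, Real.sq_sqrt hp.le]
        rwa [inv_div_inv] at this
      · simp [hν]
    · by_cases hσ : σ ∈ cells K (k + 1) ∩ cells K' (k + 1)
      · rw [if_pos hσ]
        exact hsmall.net_sqrt_rev σ hσ
      · simp [hσ]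
  rw [Real.sq_sqrt he'] at h3
  have h4 := specNorm_modDiff_le (downLaplacian_apply (K := K) o k w)
    (downLaplacian_apply (K := K') o k w') (fullDown_transpose o k w) (fullDown_transpose o k w')
  rw [diffDown]
  linarith

/-- Here 4√ε comes from the couplings, and 2ε from the created and the destroyed `(k+1)`-simplices
seen on the common `k`-simplices. -/
theorem specNorm_diffUp_le (hw : ValidWeights K k w) (hw' : ValidWeights K' k w')
    (hagree : ∀ τ ∈ common K K' (k + 2), w' τ = w τ)
    (hmid : ∀ σ ∈ common K K' (k + 1), 0 < commonMid K K' k w σ)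
    (he : 0 ≤ e) (he' : 0 ≤ e')
    (hsmall : SmallWeightChange (common K K' (k + 1)) (common K K' k)
      (weightMid K k w) (weightMid K' k w') (commonMid K K' k w)
      (weightLow K k w) (weightLow K' k w') (commonLow K K' k w) e e₀ e' e₀') :
    specNorm (diffUp K K' o k w w') ≤
      (2 * √e' + e' + 2 * e + 4 * √e) * ((k : ℝ) + 2) := by
  have hmid' : ∀ σ ∈ common K' K (k + 1), 0 < commonMid K' K k w' σ := by
    rw [common, Finset.inter_comm, commonMid_swap hagree]
    exact hmid
  have hdes : ∀ σ ∈ common K' K (k + 1), weightMid K' k w' σ / commonMid K' K k w' σ - 1 ≤ e := by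
    rw [common, Finset.inter_comm, commonMid_swap hagree]
    exact hsmall.destroyed
  have h1 := norm_mask_fullUp_created_le (o := o) he hw hmid hsmall.created
  have h2 := norm_mask_fullUp_created_le (o := o) he hw' hmid' hdes
  have h3 := norm_up_created_le (o := o) he hw hmid hsmall.created
  have h4 := norm_up_created_le (o := o) he hw' hmid' hdes
  rw [Finset.inter_comm (cells K' (k + 1))] at h2 h4
  set N := cells K (k + 1) ∩ cells K' (k + 1) with hN
  set A := scaledIncidence o N (cells K (k + 2) ∩ cells K' (k + 2)) (weightMid K k w) w with hA
  set A' := scaledIncidence o N (cells K (k + 2) ∩ cells K' (k + 2)) (weightMid K' k w') w' with hA'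
  have h5 : ‖A * Aᵀ - A' * A'ᵀ‖ ≤
      (2 * √e' + √e' ^ 2 + (1 + √e') ^ 2 * 0) * ((k : ℝ) + 2) := by
    -- Common `(k+1)`-simplices have equal weights in both complexes, so only the rows are rescaled.
    have e1 : A = Matrix.diagonal
        (fun σ => if σ ∈ N then √(weightMid K' k w' σ) / √(weightMid K k w σ) else 1) * A' := by
      ext σ τ
      rw [Matrix.diagonal_mul]
      simp only [hA, hA', scaledIncidence, Matrix.of_apply]
      by_cases hσ : σ ∈ N
      swap
      · simp [hσ]
      by_cases hτ : τ ∈ cells K (k + 2) ∩ cells K' (k + 2)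
      swap
      · simp [hτ]
      rw [if_pos hσ, if_pos hσ, if_pos hσ, if_pos hτ, if_pos hτ, hagree τ hτ]
      have hp := (Real.sqrt_pos.mpr (hw'.mid_pos σ (Finset.mem_inter.mp hσ).2)).ne'
      field_simp
    -- Transposing turns the row scaling into a column scaling; the other scaling is 1, so `t = 0`.
    have e2 := norm_gram_rescale_sub_le A'ᵀ (r₀ := fun _ => 1) (r₁ := fun σ =>
        if σ ∈ N then √(weightMid K' k w' σ) / √(weightMid K k w σ) else 1)
      (s := √e') (t := 0) (c := (k : ℝ) + 2) (Real.sqrt_nonneg _) le_rfl (by simp) (fun σ => ?_)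
      (by
        rw [l2_opNorm_transpose]
        exact norm_scaledIncidence_mid_le_sqrt hw' Finset.inter_subset_right
          Finset.inter_subset_right) (by positivity)
    · rw [Matrix.diagonal_one, Matrix.one_mul, Matrix.transpose_mul, Matrix.diagonal_transpose,
        Matrix.transpose_transpose, ← e1] at e2
      have e3 : A'ᵀ * Matrix.diagonal (fun σ => if σ ∈ N then
          √(weightMid K' k w' σ) / √(weightMid K k w σ) else 1) = Aᵀ := by
        conv_rhs => rw [e1]
        rw [Matrix.transpose_mul, Matrix.diagonal_transpose]
      rwa [e3] at e2
    · by_cases hσ : σ ∈ N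
      · rw [if_pos hσ]
        exact hsmall.net_sqrt σ hσ
      · simp [hσ]
  have h6 : ‖mask N N (fullUp K o k w) - mask N N (fullUp K' o k w')‖ ≤
      (2 * √e' + √e' ^ 2 + (1 + √e') ^ 2 * 0) * ((k : ℝ) + 2) +
        (e * ((k : ℝ) + 2) + e * ((k : ℝ) + 2)) := by
    rw [mask_fullUp o k w Finset.inter_subset_left Finset.inter_subset_left,
      mask_fullUp o k w' Finset.inter_subset_right Finset.inter_subset_right,
      scaledIncidence_mul_transpose_split o N (cells K (k + 2)) (cells K' (k + 2)),
      scaledIncidence_mul_transpose_split o N (cells K' (k + 2)) (cells K (k + 2)),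
      Finset.inter_comm (cells K' (k + 2)), add_sub_add_comm]
    refine (norm_add_le _ _).trans (add_le_add h5 ((norm_sub_le _ _).trans (add_le_add h3 h4)))
  rw [Real.sq_sqrt he'] at h6
  have h7 := specNorm_modDiff_le (upLaplacian_apply (K := K) o k w)
    (upLaplacian_apply (K := K') o k w') (fullUp_transpose o k w) (fullUp_transpose o k w')
  rw [← hN] at h7
  rw [diffUp]
  linarith

end Main

end Perturbation

/-! ### Perturbation of null spaces -/

section Spectral

open scoped Matrix.Norms.L2Operator

variable {n p : Type*} [Fintype n] [DecidableEq n] [Fintype p] [DecidableEq p]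

lemma mem_spectrum_iff_exists_mulVec {M : Matrix n n ℝ} {μ : ℝ} :
    μ ∈ spectrum ℝ M ↔ ∃ x, x ≠ 0 ∧ M *ᵥ x = μ • x := by
  rw [← Matrix.spectrum_toLin', ← Module.End.hasEigenvalue_iff_mem_spectrum]
  constructor
  · intro h
    obtain ⟨x, hx⟩ := h.exists_hasEigenvector
    exact ⟨x, hx.2, by simpa using hx.apply_eq_smul⟩
  · rintro ⟨x, hx, h⟩
    exact Module.End.hasEigenvalue_of_hasEigenvector
      (Module.End.hasEigenvector_iff.mpr ⟨Module.End.mem_eigenspace_iff.mpr (by simpa using h), hx⟩)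

/-- A version of the **Davis–Kahan theorem** for null spaces. -/
lemma exists_orthogonal_null_frames {L M : Matrix n n ℝ} (hM : M.IsHermitian) {δ : ℝ} (hδ : 0 < δ)
    (hs : ∀ μ ∈ spectrum ℝ M, μ = 0 ∨ δ ≤ μ) {X Z : Matrix n p ℝ} (hX : Xᵀ * X = 1)
    (hZ : Zᵀ * Z = 1) (hLX : L * X = 0) (hMZ : M * Z = 0)
    (hker : ∀ v, M *ᵥ v = 0 → ∃ c, v = Z *ᵥ c) :
    ∃ O ∈ Matrix.orthogonalGroup p ℝ, ∑ i, ∑ j, (X - Z * O) i j ^ 2 ≤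
      2 * (Fintype.card p * (‖L - M‖ ^ 2 / δ ^ 2)) := by
  obtain ⟨O, hO, h⟩ := exists_orthogonal_sum_sq_le hX hZ
  refine ⟨O, hO, h.trans ?_⟩
  gcongr
  rw [Finset.sum_comm]
  -- The columns of `R` are the components of those of `X` orthogonal to the null space of `M`.
  -- Since `L` kills `X` and `M` kills `Z`, applying `M` to `R` leaves only the perturbation `L - M`
  -- acting on unit vectors.
  set R := X - Z * (Zᵀ * X) with hR
  have hZR : Zᵀ * R = 0 := by
    rw [hR, Matrix.mul_sub, ← Matrix.mul_assoc, hZ, Matrix.one_mul, sub_self]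
  have hMR : M * R = -((L - M) * X) := by
    rw [hR, Matrix.mul_sub, ← Matrix.mul_assoc, hMZ, Matrix.zero_mul, Matrix.sub_mul, hLX]
    simp
  have hcol : ∀ j, ∑ i, R i j ^ 2 ≤ ‖L - M‖ ^ 2 / δ ^ 2 := by
    intro j
    rw [le_div_iff₀ (by positivity), mul_comm]
    have h1 := sq_gap_mul_le hM hδ.le hs (fun i => R i j) fun v hv => by
      obtain ⟨c, rfl⟩ := hker v hv
      have : Zᵀ *ᵥ (fun i => R i j) = 0 := by
        ext i
        exact congrFun (congrFun hZR i) j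
      rw [dotProduct_comm, Matrix.dotProduct_mulVec, ← Matrix.mulVec_transpose, this,
        zero_dotProduct]
    refine h1.trans ?_
    have h2 := sum_sq_mulVec_le (L - M) fun i => X i j
    have h3 : ∑ i, X i j ^ 2 = 1 := by
      have := congrFun (congrFun hX j) j
      simpa [Matrix.mul_apply, sq] using this
    rw [h3, mul_one] at h2
    refine le_trans (le_of_eq (Finset.sum_congr rfl fun i _ => ?_)) h2
    have h4 : (M *ᵥ fun i => R i j) i = -((L - M) *ᵥ fun i => X i j) i :=
      congrFun (congrFun hMR i) j
    rw [h4, neg_sq]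
  calc _ ≤ ∑ _j : p, ‖L - M‖ ^ 2 / δ ^ 2 := Finset.sum_le_sum fun j _ => hcol j
    _ = _ := by simp

end Spectral

/-! ### Block extensions of matrices and of null bases -/

section Glued

variable {V : Type*} [Fintype V] [LinearOrder V] {U A B : Finset (Finset V)}

/-- The matrix `glue A B M M'` on `U`. -/
def glued (U : Finset (Finset V)) {A B : Finset (Finset V)} (M : Matrix A A ℝ)
    (M' : Matrix B B ℝ) : Matrix U U ℝ :=
  Matrix.of fun σ τ => glue A B M M' σ τ

/-- The matrix `Y` with rows in `A`, extended by zero rows. -/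
def extRows (U : Finset (Finset V)) {A : Finset (Finset V)} {p : Type*} (Y : Matrix A p ℝ) :
    Matrix U p ℝ :=
  Matrix.of fun σ j => if h : (σ : Finset V) ∈ A then Y ⟨σ, h⟩ j else 0

omit [Fintype V] in
lemma glued_mulVec (hA : A ⊆ U) (M : Matrix A A ℝ) (M' : Matrix B B ℝ) (x : U → ℝ) (σ : A) :
    (glued U M M' *ᵥ x) ⟨σ, hA σ.2⟩ = (M *ᵥ fun τ => x ⟨τ, hA τ.2⟩) σ := by
  symm
  refine Fintype.sum_of_injective (fun τ : A => (⟨τ, hA τ.2⟩ : U)) (fun a b h => ?_) _ _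
    (fun τ hτ => ?_) fun τ => ?_
  · exact Subtype.ext (Subtype.mk.inj h)
  · have : (τ : Finset V) ∉ A := fun h => hτ ⟨⟨τ, h⟩, rfl⟩
    simp [glued, glue, this]
  · simp [glued, glue]

omit [Fintype V] in
lemma glued_mulVec_off (hB : B ⊆ U) (M : Matrix A A ℝ) (M' : Matrix B B ℝ) (x : U → ℝ)
    (σ : {σ : B // (σ : Finset V) ∉ A}) :
    (glued U M M' *ᵥ x) ⟨σ.1, hB σ.1.2⟩ =
      (blockOff B A M' *ᵥ fun τ => x ⟨τ.1, hB τ.1.2⟩) σ := by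
  symm
  refine Fintype.sum_of_injective
    (fun τ : {σ : B // (σ : Finset V) ∉ A} => (⟨τ.1, hB τ.1.2⟩ : U)) (fun a b h => ?_) _ _
    (fun τ hτ => ?_) fun τ => ?_
  · exact Subtype.ext (Subtype.ext (Subtype.mk.inj h))
  · have : ¬ ((τ : Finset V) ∈ B ∧ (τ : Finset V) ∉ A) := fun h => hτ ⟨⟨⟨τ, h.1⟩, h.2⟩, rfl⟩
    simp [glued, glue, this, σ.2]
  · simp [glued, glue, σ.2, τ.2, blockOff]

omit [Fintype V] in
lemma glued_isHermitian {M : Matrix A A ℝ} {M' : Matrix B B ℝ} (hM : Mᵀ = M) (hM' : M'ᵀ = M') :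
    (glued U M M').IsHermitian := by
  rw [Matrix.IsHermitian, Matrix.conjTranspose_eq_transpose_of_trivial]
  ext σ τ
  have h1 : ∀ a b, M a b = M b a := fun a b => congrFun (congrFun hM b) a
  have h2 : ∀ a b, M' a b = M' b a := fun a b => congrFun (congrFun hM' b) a
  simp only [glued, glue, Matrix.transpose_apply, Matrix.of_apply]
  by_cases hσ : (σ : Finset V) ∈ A <;> by_cases hτ : (τ : Finset V) ∈ A <;>
    by_cases hσ' : (σ : Finset V) ∈ B <;> by_cases hτ' : (τ : Finset V) ∈ B <;>
    simp [hσ, hτ, hσ', hτ', h1 ⟨τ, _⟩, h2 ⟨τ, _⟩]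

omit [Fintype V] in
-- The extension is block diagonal, so an eigenvector restricts to an eigenvector of any block on
-- which it does not vanish.
lemma mem_spectrum_glued (hA : A ⊆ U) (hB : B ⊆ U) (hU : U ⊆ A ∪ B) {M : Matrix A A ℝ}
    {M' : Matrix B B ℝ} {μ : ℝ} (h : μ ∈ spectrum ℝ (glued U M M')) :
    μ ∈ spectrum ℝ M ∨ μ ∈ spectrum ℝ (blockOff B A M') := by
  obtain ⟨x, hx, h⟩ := mem_spectrum_iff_exists_mulVec.mp h
  obtain ⟨⟨σ, hσ⟩, hne⟩ := Function.ne_iff.mp hx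
  by_cases hσA : σ ∈ A
  · refine Or.inl (mem_spectrum_iff_exists_mulVec.mpr
      ⟨fun τ => x ⟨τ, hA τ.2⟩, fun h0 => hne (congrFun h0 ⟨σ, hσA⟩), ?_⟩)
    ext τ
    rw [← glued_mulVec hA M M' x τ, h]
    rfl
  · have hσB : σ ∈ B := (Finset.mem_union.mp (hU hσ)).resolve_left hσA
    refine Or.inr (mem_spectrum_iff_exists_mulVec.mpr
      ⟨fun τ => x ⟨τ.1, hB τ.1.2⟩, fun h0 => hne (congrFun h0 ⟨⟨σ, hσB⟩, hσA⟩), ?_⟩)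
    ext τ
    rw [← glued_mulVec_off hB M M' x τ, h]
    rfl

omit [Fintype V] in
lemma extRows_transpose_mul_self (hA : A ⊆ U) {p : Type*} (Y : Matrix A p ℝ) :
    (extRows U Y)ᵀ * extRows U Y = Yᵀ * Y := by
  ext i j
  symm
  refine Fintype.sum_of_injective (fun τ : A => (⟨τ, hA τ.2⟩ : U)) (fun a b h => ?_) _ _
    (fun τ hτ => ?_) fun τ => ?_
  · exact Subtype.ext (Subtype.mk.inj h)
  · have : (τ : Finset V) ∉ A := fun h => hτ ⟨⟨τ, h⟩, rfl⟩
    simp [extRows, this]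
  · simp [extRows]

omit [Fintype V] in
lemma glued_mul_extRows (hA : A ⊆ U) (hB : B ⊆ U) (hU : U ⊆ A ∪ B) {p : Type*} {M : Matrix A A ℝ}
    (M' : Matrix B B ℝ) {Y : Matrix A p ℝ} (h : M * Y = 0) :
    glued U M M' * extRows U Y = 0 := by
  ext ⟨σ, hσ⟩ j
  change (glued U M M' *ᵥ fun τ => extRows U Y τ j) ⟨σ, hσ⟩ = 0
  by_cases hσA : σ ∈ A
  · rw [glued_mulVec hA M M' _ ⟨σ, hσA⟩]
    have : (fun τ : A => extRows U Y ⟨τ, hA τ.2⟩ j) = fun τ => Y τ j := by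
      ext τ
      simp [extRows]
    rw [this]
    exact congrFun (congrFun h ⟨σ, hσA⟩) j
  · have hσB : σ ∈ B := (Finset.mem_union.mp (hU hσ)).resolve_left hσA
    rw [glued_mulVec_off hB M M' _ ⟨⟨σ, hσB⟩, hσA⟩]
    have : (fun τ : {σ : B // (σ : Finset V) ∉ A} => extRows U Y ⟨τ.1, hB τ.1.2⟩ j) = 0 := by
      ext τ
      simp [extRows, τ.2]
    rw [this, Matrix.mulVec_zero]
    rfl

lemma IsNullBasis.mul_eq_zero {n : Type*} [Fintype n] [DecidableEq n] {b : ℕ} {L : Matrix n n ℝ}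
    {Y : Matrix n (Fin b) ℝ} (h : IsNullBasis L Y) : L * Y = 0 := by
  ext i j
  have h1 : Yᵀ j ∈ LinearMap.ker (Matrix.toLin' L) := by
    rw [← h.span_eq]
    exact Submodule.subset_span ⟨j, rfl⟩
  rw [LinearMap.mem_ker, Matrix.toLin'_apply] at h1
  exact congrFun h1 i

lemma IsNullBasis.exists_mulVec {n : Type*} [Fintype n] [DecidableEq n] {b : ℕ} {L : Matrix n n ℝ}
    {Y : Matrix n (Fin b) ℝ} (h : IsNullBasis L Y) {v : n → ℝ} (hv : L *ᵥ v = 0) :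
    ∃ c, v = Y *ᵥ c := by
  have h1 : v ∈ LinearMap.ker (Matrix.toLin' L) := by
    rwa [LinearMap.mem_ker, Matrix.toLin'_apply]
  rw [← h.span_eq] at h1
  obtain ⟨c, rfl⟩ := (Submodule.mem_span_range_iff_exists_fun ℝ).mp h1
  refine ⟨c, ?_⟩
  ext i
  simp [Matrix.mulVec, dotProduct, mul_comm]

omit [Fintype V] in
-- The added block is injective, so a null vector of the extension vanishes there and comes from the
-- null space of `M`.
lemma exists_extRows_mulVec (hA : A ⊆ U) (hB : B ⊆ U) (hU : U ⊆ A ∪ B) {b : ℕ} {M : Matrix A A ℝ}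
    {M' : Matrix B B ℝ} {Y : Matrix A (Fin b) ℝ} (hY : IsNullBasis M Y)
    (h0 : (0 : ℝ) ∉ spectrum ℝ (blockOff B A M')) {v : U → ℝ} (hv : glued U M M' *ᵥ v = 0) :
    ∃ c, v = extRows U Y *ᵥ c := by
  have h1 : M *ᵥ (fun τ => v ⟨τ, hA τ.2⟩) = 0 := by
    ext τ
    rw [← glued_mulVec hA M M' v τ, hv]
    rfl
  obtain ⟨c, hc⟩ := hY.exists_mulVec h1
  refine ⟨c, ?_⟩
  ext ⟨σ, hσ⟩
  by_cases hσA : σ ∈ A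
  · refine (congrFun hc ⟨σ, hσA⟩).trans ?_
    simp [Matrix.mulVec, dotProduct, extRows, hσA]
  · have hσB : σ ∈ B := (Finset.mem_union.mp (hU hσ)).resolve_left hσA
    have h2 : (fun τ : {σ : B // (σ : Finset V) ∉ A} => v ⟨τ.1, hB τ.1.2⟩) = 0 := by
      by_contra hne
      refine h0 (mem_spectrum_iff_exists_mulVec.mpr ⟨_, hne, ?_⟩)
      ext τ
      rw [← glued_mulVec_off hB M M' v τ, hv]
      simp
    refine (congrFun h2 ⟨⟨σ, hσB⟩, hσA⟩).trans ?_
    simp [Matrix.mulVec, dotProduct, extRows, hσA]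

omit [Fintype V] in
lemma commonRowsDistSq_le {b : ℕ} (Y : Matrix A (Fin b) ℝ) (Z : Matrix B (Fin b) ℝ)
    (O : Matrix (Fin b) (Fin b) ℝ) :
    commonRowsDistSq Y (Z * O) ≤
      ∑ σ, ∑ j, (extRows (A ∪ B) Y - extRows (A ∪ B) Z * O) σ j ^ 2 := by
  let f : (A ∩ B : Finset (Finset V)) → (A ∪ B : Finset (Finset V)) := fun σ =>
    ⟨σ, Finset.mem_union_left _ (Finset.mem_inter.mp σ.2).1⟩
  have hf : Function.Injective f := fun a b h => Subtype.ext (Subtype.mk.inj h)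
  have h1 : commonRowsDistSq Y (Z * O) = ∑ σ : (A ∩ B : Finset (Finset V)),
      ∑ j, (extRows (A ∪ B) Y - extRows (A ∪ B) Z * O) (f σ) j ^ 2 := by
    refine Finset.sum_congr rfl fun σ _ => Finset.sum_congr rfl fun j _ => ?_
    have := Finset.mem_inter.mp σ.2
    simp [f, extRows, Matrix.mul_apply, this.1, this.2, commonLeft, commonRight]
  rw [h1, ← Finset.sum_image
    (f := fun σ => ∑ j, (extRows (A ∪ B) Y - extRows (A ∪ B) Z * O) σ j ^ 2) hf.injOn]
  exact Finset.sum_le_sum_of_subset_of_nonneg (Finset.subset_univ _)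
    fun _ _ _ => Finset.sum_nonneg fun _ _ => sq_nonneg _

omit [Fintype V] in
open scoped Matrix.Norms.L2Operator in
/-- Null space bases of two symmetric matrices can be aligned on the common index set if the second
matrix, extended by a block of the first one, has a spectral gap. -/
theorem exists_orthogonal_commonRowsDistSq_le {M : Matrix A A ℝ} {M' : Matrix B B ℝ} (hM : Mᵀ = M)
    (hM' : M'ᵀ = M') {δ : ℝ} (hδ : 0 < δ) (hs : ∀ μ ∈ spectrum ℝ M', μ = 0 ∨ δ ≤ μ)
    (hoff : ∀ μ ∈ spectrum ℝ (blockOff A B M), δ ≤ μ) {b : ℕ} {Y : Matrix A (Fin b) ℝ}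
    {Y' : Matrix B (Fin b) ℝ} (hY : IsNullBasis M Y) (hY' : IsNullBasis M' Y') :
    ∃ O ∈ Matrix.orthogonalGroup (Fin b) ℝ, commonRowsDistSq Y (Y' * O) ≤
      2 * (b * (specNorm (modDiff A B M M') ^ 2 / δ ^ 2)) := by
  have hA : A ⊆ A ∪ B := Finset.subset_union_left
  have hB : B ⊆ A ∪ B := Finset.subset_union_right
  have hU' : A ∪ B ⊆ B ∪ A := (Finset.union_comm A B).subset
  -- The gap is used for the extension of `M'` by the block of `M`; of the extension of `M` it is
  -- only used that it kills the extended `Y`. The difference of the two extensions is `modDiff` by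
  -- definition.
  obtain ⟨O, hO, h⟩ := exists_orthogonal_null_frames (L := glued (A ∪ B) M M')
    (M := glued (A ∪ B) M' M) (glued_isHermitian hM' hM) hδ
    (fun μ hμ => (mem_spectrum_glued hB hA hU' hμ).elim (hs μ) fun h => Or.inr (hoff μ h))
    ((extRows_transpose_mul_self hA Y).trans hY.orthonormal)
    ((extRows_transpose_mul_self hB Y').trans hY'.orthonormal)
    (glued_mul_extRows hA hB subset_rfl M' hY.mul_eq_zero)
    (glued_mul_extRows hB hA hU' M hY'.mul_eq_zero)
    (fun v hv => exists_extRows_mulVec hB hA hU' hY' (fun h0 => (hoff 0 h0).not_gt hδ) hv)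
  refine ⟨O, hO, (commonRowsDistSq_le Y Y' O).trans ?_⟩
  rw [Fintype.card_fin] at h
  exact h

end Glued

/-! ### The spectrum of a disjoint union of complexes -/

section Components

variable {V : Type*} [Fintype V] [LinearOrder V] {K Q : PreAbstractSimplicialComplex V}
  {o : Finset V → ℤˣ} {k : ℕ} {w : Finset V → ℝ}

lemma laplacian_transpose : (laplacian K o k w)ᵀ = laplacian K o k w := by
  simp [laplacian, downLaplacian, upLaplacian]

lemma laplacian_posSemidef : (laplacian K o k w).PosSemidef := by
  have h1 := Matrix.posSemidef_conjTranspose_mul_self (matA K o k w)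
  have h2 := Matrix.posSemidef_self_mul_conjTranspose (matA' K o k w)
  simp only [Matrix.conjTranspose_eq_transpose_of_trivial] at h1 h2
  exact h1.add h2

lemma laplacian_apply (σ τ : cells K (k + 1)) :
    laplacian K o k w σ τ = fullDown K o k w σ τ + fullUp K o k w σ τ := by
  rw [laplacian, Matrix.add_apply, downLaplacian_apply, upLaplacian_apply]

/-- The subcomplex `Q` is a union of connected components of `K`. -/
structure IsComponent (Q K : PreAbstractSimplicialComplex V) : Prop where
  le : Q ≤ K
  mem_of_superset : ∀ σ ∈ Q, ∀ τ ∈ K, σ ⊆ τ → τ ∈ Q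

namespace IsComponent

omit [LinearOrder V] in
lemma mem_cells_iff (h : IsComponent Q K) {σ τ : Finset V} (hσ : σ ∈ Q) (hστ : σ ⊆ τ) (m : ℕ) :
    τ ∈ cells K m ↔ τ ∈ cells Q m := by
  rw [mem_cells, mem_cells]
  exact ⟨fun hτ => ⟨h.mem_of_superset σ hσ τ hτ.1 hστ, hτ.2⟩, fun hτ => ⟨h.le hτ.1, hτ.2⟩⟩

omit [LinearOrder V] in
lemma mem_cells_iff_of_subset (h : IsComponent Q K) {σ τ : Finset V} (hτ : τ ∈ Q) (hστ : σ ⊆ τ)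
    (m : ℕ) : σ ∈ cells K m ↔ σ ∈ cells Q m := by
  rw [mem_cells, mem_cells]
  exact ⟨fun hσ => ⟨mem_of_subset hτ (nonempty_of_mem hσ.1) hστ, hσ.2⟩,
    fun hσ => ⟨h.le hσ.1, hσ.2⟩⟩

omit [LinearOrder V] in
lemma cells_subset (h : IsComponent Q K) (m : ℕ) : cells Q m ⊆ cells K m := fun σ hσ => by
  rw [mem_cells] at hσ ⊢
  exact ⟨h.le hσ.1, hσ.2⟩

lemma degree_eq (h : IsComponent Q K) {v v' : Finset V → ℝ} {m : ℕ}
    (hv : ∀ τ ∈ cells Q m, v τ = v' τ) {σ : Finset V} (hσ : σ ∈ Q) :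
    degree (cells K m) v σ = degree (cells Q m) v' σ := by
  have : (cells K m).filter (fun τ => σ ⊆ τ) = (cells Q m).filter fun τ => σ ⊆ τ := by
    ext τ
    rw [Finset.mem_filter, Finset.mem_filter]
    exact and_congr_left fun hστ => h.mem_cells_iff hσ hστ m
  rw [degree, degree, this]
  exact Finset.sum_congr rfl fun τ hτ => hv τ (Finset.mem_filter.mp hτ).1

lemma weightMid_eq (h : IsComponent Q K) {σ : Finset V} (hσ : σ ∈ Q) :
    weightMid K k w σ = weightMid Q k w σ :=
  h.degree_eq (fun _ _ => rfl) hσ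

lemma weightLow_eq (h : IsComponent Q K) {σ : Finset V} (hσ : σ ∈ Q) :
    weightLow K k w σ = weightLow Q k w σ :=
  h.degree_eq (fun _ hτ => h.weightMid_eq (mem_cells.mp hτ).1) hσ

/-- A nonzero term needs a face shared by `σ` and `τ`. It lies in `Q` as a face of `σ`, and it
forces `τ` into `Q`, where the weights agree. In particular the row of `σ` vanishes outside `Q`. -/
lemma fullDown_eq (h : IsComponent Q K) {σ τ : Finset V} (hσ : σ ∈ cells Q (k + 1))
    (hτ : τ ∈ cells K (k + 1)) :
    fullDown K o k w σ τ = fullDown Q o k w σ τ := by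
  simp only [fullDown, Matrix.mul_apply, Matrix.transpose_apply, scaledIncidence, Matrix.of_apply]
  refine Finset.sum_congr rfl fun ν _ => ?_
  have hσQ := (mem_cells.mp hσ).1
  by_cases hνσ : ν ⊆ σ
  swap
  · simp [signedIncidence_eq_zero o hνσ]
  by_cases hντ : ν ⊆ τ
  swap
  · simp [signedIncidence_eq_zero o hντ]
  by_cases hν : ν ∈ cells Q k
  · have hνQ := (mem_cells.mp hν).1
    have hτ' := (h.mem_cells_iff hνQ hντ _).mp hτ
    rw [if_pos hν, if_pos hσ, if_pos hτ', if_pos hτ, if_pos (h.cells_subset _ hν),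
      if_pos (h.cells_subset _ hσ), h.weightLow_eq hνQ, h.weightMid_eq hσQ,
      h.weightMid_eq (mem_cells.mp hτ').1]
  · have hν' : ν ∉ cells K k := fun h' => hν ((h.mem_cells_iff_of_subset hσQ hνσ _).mp h')
    simp [hν, hν']

lemma fullUp_eq (h : IsComponent Q K) {σ τ : Finset V} (hσ : σ ∈ cells Q (k + 1))
    (hτ : τ ∈ cells K (k + 1)) :
    fullUp K o k w σ τ = fullUp Q o k w σ τ := by
  simp only [fullUp, Matrix.mul_apply, Matrix.transpose_apply, scaledIncidence, Matrix.of_apply]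
  refine Finset.sum_congr rfl fun ρ _ => ?_
  have hσQ := (mem_cells.mp hσ).1
  by_cases hσρ : σ ⊆ ρ
  swap
  · simp [signedIncidence_eq_zero o hσρ]
  by_cases hτρ : τ ⊆ ρ
  swap
  · simp [signedIncidence_eq_zero o hτρ]
  by_cases hρ : ρ ∈ cells Q (k + 2)
  · have hτ' := (h.mem_cells_iff_of_subset (mem_cells.mp hρ).1 hτρ _).mp hτ
    rw [if_pos hρ, if_pos hσ, if_pos hτ', if_pos hτ, if_pos (h.cells_subset _ hρ),
      if_pos (h.cells_subset _ hσ), h.weightMid_eq hσQ, h.weightMid_eq (mem_cells.mp hτ').1]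
  · have hρ' : ρ ∉ cells K (k + 2) := fun h' => hρ ((h.mem_cells_iff hσQ hσρ _).mp h')
    simp [hρ, hρ']

lemma laplacian_mulVec (h : IsComponent Q K) (x : cells K (k + 1) → ℝ) (σ : cells Q (k + 1)) :
    (laplacian K o k w *ᵥ x) ⟨σ, h.cells_subset _ σ.2⟩ =
      (laplacian Q o k w *ᵥ fun τ => x ⟨τ, h.cells_subset _ τ.2⟩) σ := by
  symm
  refine Fintype.sum_of_injective
    (fun τ : cells Q (k + 1) => (⟨τ, h.cells_subset _ τ.2⟩ : cells K (k + 1)))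
    (fun a b h => Subtype.ext (Subtype.mk.inj h)) _ _ (fun τ hτ => ?_) fun τ => ?_
  · have hτ' : (τ : Finset V) ∉ cells Q (k + 1) := fun h' => hτ ⟨⟨τ, h'⟩, rfl⟩
    change laplacian K o k w ⟨σ, h.cells_subset _ σ.2⟩ τ * x τ = 0
    rw [laplacian_apply, h.fullDown_eq σ.2 τ.2, h.fullUp_eq σ.2 τ.2]
    simp [fullDown, fullUp, Matrix.mul_apply, scaledIncidence, hτ']
  · change laplacian Q o k w σ τ * _ =
      laplacian K o k w ⟨σ, h.cells_subset _ σ.2⟩ ⟨τ, h.cells_subset _ τ.2⟩ * _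
    rw [laplacian_apply, laplacian_apply, h.fullDown_eq σ.2 (h.cells_subset _ τ.2),
      h.fullUp_eq σ.2 (h.cells_subset _ τ.2)]

end IsComponent

omit [Fintype V] in
lemma incidence_ne_zero {ν σ : Finset V} (h : ν ⊆ σ) (hc : σ.card = ν.card + 1) :
    incidence ν σ ≠ 0 := by
  obtain ⟨v, hv, rfl⟩ := (Finset.covBy_iff_card_sdiff_eq_one.mpr
    ⟨h, by rw [Finset.card_sdiff_of_subset h]; omega⟩).exists_finset_cons
  intro h0
  have h1 := incidence_sq ν (Finset.cons v ν hv)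
  rw [h0, zero_pow two_ne_zero, eq_comm,
    Finset.sum_eq_zero_iff_of_nonneg fun u _ => by split_ifs <;> norm_num] at h1
  have := h1 v (Finset.mem_cons_self _ _)
  simp [hv] at this

/-- A positive weight of `σ` requires a coface of positive weight, and that makes the diagonal entry
of the up Laplacian at `σ` positive. -/
lemma laplacian_ne_zero {σ : Finset V} (hσ : σ ∈ cells K (k + 1)) (hpos : 0 < weightMid K k w σ) :
    laplacian K o k w ≠ 0 := by
  intro h0
  obtain ⟨τ, hτ, hwτ⟩ : ∃ τ ∈ (cells K (k + 2)).filter (fun τ => σ ⊆ τ), 0 < w τ := by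
    by_contra! hcon
    exact (Finset.sum_nonpos hcon).not_gt hpos
  obtain ⟨hτK, hστ⟩ := Finset.mem_filter.mp hτ
  have h1 : matA' K o k w ⟨σ, hσ⟩ ⟨τ, hτK⟩ ≠ 0 := by
    rw [matA', normBoundary_apply]
    have hi := incidence_ne_zero hστ
      (by rw [(mem_cells.mp hτK).2, (mem_cells.mp hσ).2])
    have hs : signedIncidence o σ τ ≠ 0 := by
      rw [← pow_ne_zero_iff two_ne_zero, signedIncidence_sq]
      exact pow_ne_zero _ hi
    simp only [scaledIncidence, Matrix.of_apply, if_pos hσ]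
    rw [if_pos hτK]
    exact mul_ne_zero (mul_ne_zero (inv_ne_zero (Real.sqrt_pos.mpr hpos).ne') hs)
      (Real.sqrt_pos.mpr hwτ).ne'
  have h2 : 0 ≤ downLaplacian K o k w ⟨σ, hσ⟩ ⟨σ, hσ⟩ :=
    Finset.sum_nonneg fun _ _ => mul_self_nonneg _
  have h3 : 0 < upLaplacian K o k w ⟨σ, hσ⟩ ⟨σ, hσ⟩ :=
    Finset.sum_pos' (fun _ _ => mul_self_nonneg _) ⟨⟨τ, hτK⟩, Finset.mem_univ _,
      mul_self_pos.mpr h1⟩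
  have h4 : laplacian K o k w ⟨σ, hσ⟩ ⟨σ, hσ⟩ = 0 := by rw [h0]; rfl
  rw [laplacian, Matrix.add_apply] at h4
  linarith

/-- A nonzero positive semidefinite matrix has a nonzero eigenvalue, and the infimum over its finite
spectrum is attained. -/
lemma eigengap_pos {n : Type*} [Fintype n] [DecidableEq n] {M : Matrix n n ℝ}
    (hM : M.PosSemidef) (h0 : M ≠ 0) : 0 < eigengap M := by
  have hfin : (spectrum ℝ M \ {0}).Finite := (Matrix.finite_real_spectrum (𝕜 := ℝ)).sdiff
  have hne : (spectrum ℝ M \ {0}).Nonempty := by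
    by_contra hcon
    rw [Set.not_nonempty_iff_eq_empty, Set.sdiff_eq_empty] at hcon
    exact h0 (hM.isHermitian.eigenvalues_eq_zero_iff.mp
      (funext fun i => hcon (hM.isHermitian.eigenvalues_mem_spectrum_real i)))
  have hmem := hne.csInf_mem hfin
  rw [← eigengap] at hmem
  refine lt_of_le_of_ne ?_ fun h => hmem.2 h.symm
  have h1 := hmem.1
  rw [hM.isHermitian.spectrum_real_eq_range_eigenvalues] at h1
  obtain ⟨i, hi⟩ := h1
  rw [← hi]
  exact hM.eigenvalues_nonneg i

lemma eigengap_le {n : Type*} [Fintype n] [DecidableEq n] {M : Matrix n n ℝ} {μ : ℝ}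
    (h : μ ∈ spectrum ℝ M) (h0 : μ ≠ 0) : eigengap M ≤ μ :=
  csInf_le (Matrix.finite_real_spectrum (𝕜 := ℝ)).sdiff.bddBelow ⟨h, h0⟩

variable {ι : Type*} {P : ι → PreAbstractSimplicialComplex V}

omit [Fintype V] [LinearOrder V] in
lemma mem_iSup_complex {σ : Finset V} : σ ∈ ⨆ i, P i ↔ ∃ i, σ ∈ P i := by
  change σ ∈ ⋃ L ∈ Set.range P, L.faces ↔ _
  simp only [Set.mem_iUnion, Set.mem_range, exists_prop, exists_exists_eq_and]
  rfl

omit [Fintype V] [LinearOrder V] in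
lemma isComponent_iSup (hdisj : ∀ i j, i ≠ j → ∀ s ∈ P i, ∀ t ∈ P j, Disjoint s t) (i : ι) :
    IsComponent (P i) (⨆ i, P i) := by
  refine ⟨le_iSup P i, fun σ hσ τ hτ hστ => ?_⟩
  obtain ⟨j, hj⟩ := mem_iSup_complex.mp hτ
  by_cases hij : i = j
  · exact hij ▸ hj
  · have h1 := hdisj i j hij σ hσ τ hj
    have h2 := nonempty_of_mem hσ
    exact absurd (h1.eq_bot_of_le hστ) h2.ne_empty

lemma iInf_eigengap_pos [Finite ι] [Nonempty ι]
    (hdisj : ∀ i j, i ≠ j → ∀ s ∈ P i, ∀ t ∈ P j, Disjoint s t)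
    (hne : ∀ i, (cells (P i) (k + 1)).Nonempty) (hw : ValidWeights (⨆ i, P i) k w) :
    0 < ⨅ i, eigengap (laplacian (P i) o k w) := by
  obtain ⟨i, hi⟩ := exists_eq_ciInf_of_finite (f := fun i => eigengap (laplacian (P i) o k w))
  rw [← hi]
  obtain ⟨σ, hσ⟩ := hne i
  have hc := isComponent_iSup hdisj i
  refine eigengap_pos laplacian_posSemidef (laplacian_ne_zero hσ ?_)
  rw [← hc.weightMid_eq (mem_cells.mp hσ).1]
  exact hw.mid_pos σ (hc.cells_subset _ hσ)

/-- An eigenvector is nonzero on some simplex; its restriction to the piece containing that simplex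
is an eigenvector of the Laplacian of the piece. -/
lemma eq_zero_or_iInf_eigengap_le [Finite ι]
    (hdisj : ∀ i j, i ≠ j → ∀ s ∈ P i, ∀ t ∈ P j, Disjoint s t) {μ : ℝ}
    (hμ : μ ∈ spectrum ℝ (laplacian (⨆ i, P i) o k w)) :
    μ = 0 ∨ ⨅ i, eigengap (laplacian (P i) o k w) ≤ μ := by
  by_cases h0 : μ = 0
  · exact Or.inl h0
  obtain ⟨x, hx, h⟩ := mem_spectrum_iff_exists_mulVec.mp hμ
  obtain ⟨⟨σ, hσ⟩, hne⟩ := Function.ne_iff.mp hx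
  obtain ⟨i, hi⟩ := mem_iSup_complex.mp (mem_cells.mp hσ).1
  have hc := isComponent_iSup hdisj i
  have hσi : σ ∈ cells (P i) (k + 1) := mem_cells.mpr ⟨hi, (mem_cells.mp hσ).2⟩
  refine Or.inr ((ciInf_le (Set.finite_range _).bddBelow i).trans (eigengap_le ?_ h0))
  refine mem_spectrum_iff_exists_mulVec.mpr ⟨fun τ => x ⟨τ, hc.cells_subset _ τ.2⟩,
    fun h1 => hne (congrFun h1 ⟨σ, hσi⟩), ?_⟩
  ext τ
  rw [← hc.laplacian_mulVec x τ, h]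
  rfl

end Components

/-! ### Combining the down and up parts -/

section Sum

variable {V : Type*} [Fintype V] [LinearOrder V] {K K' : PreAbstractSimplicialComplex V}
  {o : Finset V → ℤˣ} {k : ℕ} {w w' : Finset V → ℝ}

lemma diffDown_add_diffUp : diffDown K K' o k w w' + diffUp K K' o k w w' =
    modDiff _ _ (laplacian K o k w) (laplacian K' o k w') := by
  ext σ τ
  simp only [diffDown, diffUp, modDiff, glue, laplacian, Matrix.add_apply, Matrix.of_apply]
  split_ifs <;> ring

lemma specNorm_modDiff_laplacian_sq_le :
    specNorm (modDiff _ _ (laplacian K o k w) (laplacian K' o k w')) ^ 2 ≤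
      2 * (specNorm (diffDown K K' o k w w') ^ 2 + specNorm (diffUp K K' o k w w') ^ 2) := by
  have h : specNorm (modDiff _ _ (laplacian K o k w) (laplacian K' o k w')) ≤
      specNorm (diffDown K K' o k w w') + specNorm (diffUp K K' o k w w') := by
    rw [← diffDown_add_diffUp, specNorm, map_add]
    exact norm_add_le _ _
  have h0 : 0 ≤ specNorm (modDiff _ _ (laplacian K o k w) (laplacian K' o k w')) := norm_nonneg _
  nlinarith [sq_nonneg (specNorm (diffDown K K' o k w w') - specNorm (diffUp K K' o k w w'))]

end Sum

end HodgeGluing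

end

/-! ### The main theorem -/

theorem theorem1 {V : Type*} [Fintype V] [LinearOrder V] {ι : Type*} [Fintype ι] [Nonempty ι]
    (k : ℕ) (o : Finset V → ℤˣ)
    -- the glued complex, the pieces before gluing, and the weights of the `(k+1)`-simplices
    (K : PreAbstractSimplicialComplex V) (P : ι → PreAbstractSimplicialComplex V)
    (w w' : Finset V → ℝ)
    (hdisj : ∀ i j, i ≠ j → ∀ s ∈ P i, ∀ t ∈ P j, Disjoint s t)
    (hne : ∀ i, (cells (P i) (k + 1)).Nonempty)
    (hw : ValidWeights K k w) (hw' : ValidWeights (⨆ i, P i) k w')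
    (hagree : ∀ τ ∈ common K (⨆ i, P i) (k + 2), w' τ = w τ)
    (hmid : ∀ σ ∈ common K (⨆ i, P i) (k + 1), 0 < commonMid K (⨆ i, P i) k w σ)
    (hlow : ∀ ν ∈ common K (⨆ i, P i) k, 0 < commonLow K (⨆ i, P i) k w ν)
    -- no `k`-homology is created
    (hbetti : betti K o k w = ∑ i, betti (P i) o k w')
    -- eigengap conditions on the blocks of created and of destroyed simplices
    (hgapC : ∀ μ ∈ spectrum ℝ
        (blockOff (cells K (k + 1)) (cells (⨆ i, P i) (k + 1)) (laplacian K o k w)),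
      ⨅ i, eigengap (laplacian (P i) o k w') ≤ μ)
    (hgapD : ∀ μ ∈ spectrum ℝ
        (blockOff (cells (⨆ i, P i) (k + 1)) (cells K (k + 1)) (laplacian (⨆ i, P i) o k w')),
      ⨅ i, eigengap (laplacian (P i) o k w') ≤ μ)
    -- the weights change only slightly
    (e e₀ e' e₀' : ℝ) (he : 0 ≤ e) (he₀ : 0 ≤ e₀) (he' : 0 ≤ e') (he₀' : 0 ≤ e₀')
    (hsmall : SmallWeightChange (common K (⨆ i, P i) (k + 1)) (common K (⨆ i, P i) k)
      (weightMid K k w) (weightMid (⨆ i, P i) k w') (commonMid K (⨆ i, P i) k w)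
      (weightLow K k w) (weightLow (⨆ i, P i) k w') (commonLow K (⨆ i, P i) k w)
      e e₀ e' e₀') :
    specNorm (diffDown K (⨆ i, P i) o k w w') ^ 2 ≤
        (2 * √e' + e' + (1 + √e') ^ 2 * √e₀' + 4 * √e₀) ^ 2 * ((k : ℝ) + 1) ^ 2 ∧
    specNorm (diffUp K (⨆ i, P i) o k w w') ^ 2 ≤
        (2 * √e' + e' + 2 * e + 4 * √e) ^ 2 * ((k : ℝ) + 2) ^ 2 ∧
    ∀ (Y : Matrix (cells K (k + 1)) (Fin (betti K o k w)) ℝ)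
      (Y' : Matrix (cells (⨆ i, P i) (k + 1)) (Fin (betti K o k w)) ℝ),
      IsNullBasis (laplacian K o k w) Y →
      IsNullBasis (laplacian (⨆ i, P i) o k w') Y' →
      ∃ O ∈ Matrix.orthogonalGroup (Fin (betti K o k w)) ℝ,
        commonRowsDistSq Y (Y' * O) ≤
          8 * (betti K o k w : ℝ) *
              (specNorm (diffDown K (⨆ i, P i) o k w w') ^ 2 +
                specNorm (diffUp K (⨆ i, P i) o k w w') ^ 2) /
            (⨅ i, eigengap (laplacian (P i) o k w')) ^ 2 := by
  have hδ := iInf_eigengap_pos (o := o) hdisj hne hw'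
  refine ⟨?_, ?_, fun Y Y' hY hY' => ?_⟩
  · rw [← mul_pow]
    exact pow_le_pow_left₀ (norm_nonneg _)
      (specNorm_diffDown_le hw hw' hagree hlow he₀ he' hsmall) 2
  · rw [← mul_pow]
    exact pow_le_pow_left₀ (norm_nonneg _)
      (specNorm_diffUp_le hw hw' hagree hmid he he' hsmall) 2
  · obtain ⟨O, hO, h⟩ := exists_orthogonal_commonRowsDistSq_le laplacian_transpose
      laplacian_transpose hδ (fun μ hμ => eq_zero_or_iInf_eigengap_le hdisj hμ) hgapC hY hY'
    refine ⟨O, hO, h.trans ?_⟩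
    rw [← mul_div_assoc, ← mul_div_assoc]
    refine div_le_div_of_nonneg_right ?_ (by positivity)
    have hsum := specNorm_modDiff_laplacian_sq_le (K := K) (K' := ⨆ i, P i) (o := o) (k := k)
      (w := w) (w' := w')
    have hb : (0 : ℝ) ≤ betti K o k w := Nat.cast_nonneg _
    have hnn : 0 ≤ specNorm (diffDown K (⨆ i, P i) o k w w') ^ 2 +
        specNorm (diffUp K (⨆ i, P i) o k w w') ^ 2 := by positivity
    -- The Procrustes factor 2 and the factor 2 from (a + b)² ≤ 2(a² + b²) give the constant 4,
    -- which is within 8.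
    nlinarith [mul_le_mul_of_nonneg_left hsum hb, mul_nonneg hb hnn]
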